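/- Fix an o-minimal structure on the real field $(\mathbb R,+,\cdot)$; "definable" means definable in it with real parameters. A $C^2$ submanifold of $\mathbb R^n$ is an embedded one, of some constant dimension and not necessarily closed. For linear subspaces $A,B\subset\mathbb R^n$ and $v\in\mathbb R^n$ put $\eta(v,B)=\sup\{\langle v,m\rangle : m\in B^{\perp},\ \|m\|=1\}$ and $d(A,B)=\sup\{\eta(v,B): v\in A,\ \|v\|=1\}$ (a supremum over the empty set being $0$). Let $X,Y\subset\mathbb R^n$ be disjoint $C^2$ submanifolds, let $p\in X$, and let $\pi$ be a local retraction onto $X$ near $p$ (the nearest point retraction, or any retraction of class $C^1$). For $y\in Y$ near $p$ put $$\alpha(y)=d(T_{\pi(y)}X,T_yY),\qquad \beta(y)=\eta\Big(\tfrac{\pi(y)-y}{\|\pi(y)-y\|},T_yY\Big),\qquad R(y)=\frac{\|y-p\|\,\alpha(y)}{\|y-\pi(y)\|}.$$ The pair $(Y,X)$ satisfies at $p$: Whitney's condition $(b)$ if $\alpha(y)\to0$ and $\beta(y)\to 0$ as $y\to p$, $y\in Y$; Kuo's ratio test $(r)$ if $R(y)\to0$ as $y\to p$, $y\in Y$;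 the Kuo–Verdier condition $(w)$ if $d(T_xX,T_yY)/\|x-y\|$ is bounded for $y\in Y$, $x\in X$ near $p$. 1. If $X$ and $Y$ are disjoint definable $C^2$ submanifolds of $\mathbb R^n$, of any dimensions, and $(Y,X)$ satisfies $(r)$ at $p\in X$, then $(Y,X)$ satisfies $(b)$ at $p$ (with respect to the same $\pi$). 2. Consequently $(w)$ implies $(b)$ for definable stratifications: if a set $S\subset\mathbb R^n$ is partitioned into a locally finite family of definable $C^2$ submanifolds (strata), and $X\neq Y$ are strata such that $(Y,X)$ satisfies $(w)$ at $p\in X$, then $(Y,X)$ satisfies $(b)$ at $p$ (for every local retraction $\pi$ as above). -/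

import Mathlib

open Set Filter Topology

universe u v

noncomputable section

namespace Strata

/-- Euclidean space `ℝⁿ`. -/
abbrev E (n : ℕ) : Type := EuclideanSpace ℝ (Fin n)

/-! ### O-minimal structures on the real field -/

/-- The first-order structure `L` on `ℝ` is an o-minimal structure on the real field: addition and
multiplication are definable (hence so is the order), and every definable subset of `ℝ` is a finite
union of intervals (of any kind, points included). Definability is with real parameters. The
order-connected subsets of `ℝ` are exactly the intervals. -/
structure IsOMinimal (L : FirstOrder.Language.{u, v}) [L.Structure ℝ] : Prop where
  add_definable : (univ : Set ℝ).Definable L {w : Fin 3 → ℝ | w 0 + w 1 = w 2}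
  mul_definable : (univ : Set ℝ).Definable L {w : Fin 3 → ℝ | w 0 * w 1 = w 2}
  finite_union_intervals : ∀ s : Set ℝ, (univ : Set ℝ).Definable₁ L s →
    ∃ F : Set (Set ℝ), F.Finite ∧ (∀ I ∈ F, I.OrdConnected) ∧ s = ⋃₀ F

/-- A subset of `ℝⁿ` is definable (with real parameters) in the structure `L`. -/
def IsDefinable (L : FirstOrder.Language.{u, v}) [L.Structure ℝ] {n : ℕ} (A : Set (E n)) : Prop :=
  (univ : Set ℝ).Definable L {w : Fin n → ℝ | WithLp.toLp 2 w ∈ A}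

/-! ### Submanifolds and tangent spaces -/

/-- `M` is a (not necessarily closed) embedded `C²` submanifold of `ℝⁿ` of dimension `d`: near each
of its points a `C²` diffeomorphism between open sets straightens it to a `d`-dimensional linear
subspace. -/
def IsC2Submanifold {n : ℕ} (d : ℕ) (M : Set (E n)) : Prop :=
  ∀ p ∈ M, ∃ (φ : OpenPartialHomeomorph (E n) (E n)) (V : Submodule ℝ (E n)),
    p ∈ φ.source ∧ ContDiffOn ℝ 2 φ φ.source ∧ ContDiffOn ℝ 2 φ.symm φ.target ∧
    Module.finrank ℝ V = d ∧ ∀ x ∈ φ.source, x ∈ M ↔ φ x ∈ V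

/-- The tangent space `T_p M`, as a linear subspace of `ℝⁿ`. (For a submanifold the tangent cone is
already a linear space.) -/
def tangent {n : ℕ} (M : Set (E n)) (p : E n) : Submodule ℝ (E n) :=
  Submodule.span ℝ (tangentConeAt ℝ M p)

/-- `π` is the canonical (nearest point) retraction onto `X` near `p`. -/
def IsNearestPointRetraction {n : ℕ} (X : Set (E n)) (p : E n) (π : E n → E n) : Prop :=
  ∀ᶠ y in 𝓝 p, π y ∈ X ∧ dist y (π y) = Metric.infDist y X

/-- `π` is a retraction of class `C¹` onto `X` near `p`. -/
def IsC1Retraction {n : ℕ} (X : Set (E n)) (p : E n) (π : E n → E n) : Prop :=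
  ContDiffAt ℝ 1 π p ∧ ∀ᶠ y in 𝓝 p, π y ∈ X ∧ (y ∈ X → π y = y)

/-- Local retractions onto `X` near `p`: the canonical one, or any one of class `C¹`. -/
def IsLocalRetraction {n : ℕ} (X : Set (E n)) (p : E n) (π : E n → E n) : Prop :=
  IsNearestPointRetraction X p π ∨ IsC1Retraction X p π

/-! ### Angles between vectors and subspaces -/

/-- The distance of a vector `v` to a subspace `B`, as the supremum of `⟨v, m⟩` over the unit
normals `m` of `B` (equal to `0` if `B` is the whole space, where there are none). -/
def eta {n : ℕ} (v : E n) (B : Submodule ℝ (E n)) : ℝ :=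
  sSup {r : ℝ | ∃ m ∈ Bᗮ, ‖m‖ = 1 ∧ r = inner ℝ v m}

/-- `d(A, B) = sup {η(v, B) : v ∈ A, ‖v‖ = 1}` (equal to `0` if `A = 0`). -/
def subspaceDist {n : ℕ} (A B : Submodule ℝ (E n)) : ℝ :=
  sSup {r : ℝ | ∃ v ∈ A, ‖v‖ = 1 ∧ r = eta v B}

/-- `α_{Y,X}(y) = d(T_{π(y)} X, T_y Y)`. -/
def alpha {n : ℕ} (Y X : Set (E n)) (π : E n → E n) (y : E n) : ℝ :=
  subspaceDist (tangent X (π y)) (tangent Y y)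

/-- `β_{Y,X}(y)`: the distance to `T_y Y` of the unit vector in the direction `π(y) - y`. -/
def beta {n : ℕ} (Y : Set (E n)) (π : E n → E n) (y : E n) : ℝ :=
  eta (‖π y - y‖⁻¹ • (π y - y)) (tangent Y y)

/-- Kuo's ratio, based at the point `p` of `X`. -/
def kuoRatio {n : ℕ} (Y X : Set (E n)) (p : E n) (π : E n → E n) (y : E n) : ℝ :=
  ‖y - p‖ * alpha Y X π y / ‖π y - y‖

/-- The Kuo-Verdier ratio. -/
def verdierRatio {n : ℕ} (Y X : Set (E n)) (y x : E n) : ℝ :=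
  subspaceDist (tangent X x) (tangent Y y) / ‖x - y‖

/-! ### Regularity conditions for the pair `(Y, X)` at `p ∈ X` -/

/-- Whitney's condition (b). -/
def ConditionB {n : ℕ} (Y X : Set (E n)) (p : E n) (π : E n → E n) : Prop :=
  Tendsto (alpha Y X π) (𝓝[Y] p) (𝓝 0) ∧ Tendsto (beta Y π) (𝓝[Y] p) (𝓝 0)

/-- Kuo's ratio test (r). -/
def ConditionR {n : ℕ} (Y X : Set (E n)) (p : E n) (π : E n → E n) : Prop :=
  Tendsto (kuoRatio Y X p π) (𝓝[Y] p) (𝓝 0)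

/-- The Kuo-Verdier condition (w). -/
def ConditionW {n : ℕ} (Y X : Set (E n)) (p : E n) : Prop :=
  ∃ C : ℝ, ∃ U ∈ 𝓝 p, ∀ y ∈ Y ∩ U, ∀ x ∈ X ∩ U, verdierRatio Y X y x ≤ C

/-! ### Definable stratifications -/

/-- `S` is partitioned into a locally finite family of `C²` submanifolds, the strata, which are
definable in `L`. -/
structure IsDefinableStratification (L : FirstOrder.Language.{u, v}) [L.Structure ℝ] {n : ℕ}
    (S : Set (E n)) (strata : Set (Set (E n))) : Prop where
  sUnion_eq : ⋃₀ strata = S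
  pairwise_disjoint : ∀ X ∈ strata, ∀ Y ∈ strata, X ≠ Y → Disjoint X Y
  locally_finite : ∀ p : E n, ∃ U ∈ 𝓝 p, {X ∈ strata | (X ∩ U).Nonempty}.Finite
  submanifold : ∀ X ∈ strata, ∃ d : ℕ, IsC2Submanifold d X
  definable : ∀ X ∈ strata, IsDefinable L X

end Strata

end

/-! The half of (b) about `alpha` is immediate. A local retraction satisfies `‖π y - y‖ ≤ C ‖x - y‖`
for all `x ∈ X` near `p`; taking `x = p` bounds `alpha` by `C` times Kuo's ratio.

The half about `beta` is proved by contradiction along a definable curve. If `beta` stays above `ε`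
at points of `Y` arbitrarily close to `p`, each such `y` has a unit normal `m` of `T_y Y` making a
definite angle with `π y - y`. Since `π` need not be definable, its graph is replaced by a definable
relation: `x ∈ X` is as near to `y`, up to the factor `C`, as any point of `X` close to `p`. The
normal bundle of `Y` is definable, so `IsOMinimal.exists_curve` yields definable `y`, `x`, `m` with
`‖y t - p‖ = t`.

The core is `IsOMinimal.exists_frequently_tangent`. Put `q = x - y`, let `m₀ = lim m` and `H = ⟨q,
m₀⟩`. Then `H` is comparable to `‖q‖`, so `‖q'‖` is at most a multiple of `H'`, and `H' ≥ c H / t`.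
As `y'` is tangent to `Y` and hence orthogonal to `m`, `H'` equals `⟨x', m⟩` up to an error of at
most `H' / 2`. Thus `t |⟨x', m⟩|` is at least a multiple of `‖q‖`, with `x'` bounded and tangent to
`X`. Because tangent spaces of a `C²` submanifold vary in a Lipschitz way, `x'` can be moved to
`T_{π y} X`; then the ratio test makes `t |⟨x', m⟩|` negligible compared with `‖q‖`, a
contradiction.

From o-minimality only three facts are needed: definable choice, monotonicity of germs, and its
consequence that inequalities between germs with limit `0` pass to derivatives. Smoothness of
definable curves is not required: Lebesgue's theorem on monotone functions gives derivatives at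
points arbitrarily close to `0`.

Finally, Kuo's ratio is `‖y - p‖` times the Kuo-Verdier ratio at `x = π y`, so (w) implies (r). -/

namespace Strata

/-! ### Definable predicates and functions -/

section Definability

variable {L : FirstOrder.Language.{u, v}} [L.Structure ℝ] {α β : Type}

/-- A predicate on tuples of reals that is definable with real parameters. -/
def DefPred (L : FirstOrder.Language.{u, v}) [L.Structure ℝ] (P : (α → ℝ) → Prop) : Prop :=
  (univ : Set ℝ).Definable L {w | P w}

/-- A real function of tuples of reals that is definable with real parameters. -/
def DefFun (L : FirstOrder.Language.{u, v}) [L.Structure ℝ] (f : (α → ℝ) → ℝ) : Prop :=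
  (univ : Set ℝ).DefinableFun L f

theorem DefPred.and {P Q : (α → ℝ) → Prop} (hP : DefPred L P) (hQ : DefPred L Q) :
    DefPred L fun w => P w ∧ Q w :=
  hP.inter hQ

theorem DefPred.or {P Q : (α → ℝ) → Prop} (hP : DefPred L P) (hQ : DefPred L Q) :
    DefPred L fun w => P w ∨ Q w :=
  hP.union hQ

theorem DefPred.not {P : (α → ℝ) → Prop} (hP : DefPred L P) : DefPred L fun w => ¬ P w :=
  hP.compl

theorem DefPred.congr {P Q : (α → ℝ) → Prop} (hP : DefPred L P) (h : ∀ w, P w ↔ Q w) :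
    DefPred L Q := by
  have : P = Q := funext fun w => propext (h w)
  exact this ▸ hP

theorem DefPred.imp {P Q : (α → ℝ) → Prop} (hP : DefPred L P) (hQ : DefPred L Q) :
    DefPred L fun w => P w → Q w :=
  (hP.not.or hQ).congr fun _ => imp_iff_not_or.symm

theorem DefPred.comp [Finite β] {P : (β → ℝ) → Prop} (hP : DefPred L P)
    {F : (α → ℝ) → β → ℝ} (hF : ∀ b, DefFun L fun v => F v b) : DefPred L fun v => P (F v) :=
  Set.Definable.preimage_map hF hP

theorem DefFun.comp [Finite β] {f : (β → ℝ) → ℝ} (hf : DefFun L f)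
    {F : (α → ℝ) → β → ℝ} (hF : ∀ b, DefFun L fun v => F v b) : DefFun L fun v => f (F v) :=
  Set.DefinableFun.comp hF hf

theorem DefFun.coord (a : α) : DefFun L fun w : α → ℝ => w a :=
  Set.DefinableFun.proj L

theorem DefFun.const (c : ℝ) : DefFun L fun _ : α → ℝ => c :=
  FirstOrder.Language.definableFun_const L α (mem_univ c)

theorem DefFun.eq {f g : (α → ℝ) → ℝ} (hf : DefFun L f) (hg : DefFun L g) :
    DefPred L fun w => f w = g w :=
  Set.DefinableFun.ofPred_eq hf hg

theorem DefFun.ite {P : (α → ℝ) → Prop} [DecidablePred P] {f g : (α → ℝ) → ℝ}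
    (hP : DefPred L P) (hf : DefFun L f) (hg : DefFun L g) :
    DefFun L fun w => if P w then f w else g w :=
  Set.DefinableFun.ite hP hf hg

/-- A function is definable if its graph is. -/
theorem DefFun.of_graph {f : (α → ℝ) → ℝ}
    (h : DefPred L fun w : Option α → ℝ => f (fun a => w (some a)) = w none) : DefFun L f := by
  unfold DefFun Set.DefinableFun
  exact h

theorem DefPred.exists_block [Finite β] {P : (α → ℝ) → (β → ℝ) → Prop}
    (h : DefPred L fun w : α ⊕ β → ℝ => P (fun a => w (.inl a)) (fun b => w (.inr b))) :
    DefPred L fun v => ∃ z, P v z := by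
  unfold DefPred at h
  exact h.exists_of_finite

theorem DefPred.exists_real {P : (α → ℝ) → ℝ → Prop}
    (h : DefPred L fun w : α ⊕ Fin 1 → ℝ => P (fun a => w (.inl a)) (w (.inr 0))) :
    DefPred L fun v => ∃ x, P v x :=
  (DefPred.exists_block (P := fun v (z : Fin 1 → ℝ) => P v (z 0)) h).congr fun _ =>
    ⟨fun ⟨z, hz⟩ => ⟨z 0, hz⟩, fun ⟨x, hx⟩ => ⟨fun _ => x, hx⟩⟩

theorem DefPred.forall_real {P : (α → ℝ) → ℝ → Prop}
    (h : DefPred L fun w : α ⊕ Fin 1 → ℝ => P (fun a => w (.inl a)) (w (.inr 0))) :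
    DefPred L fun v => ∀ x, P v x :=
  (DefPred.exists_real (P := fun v x => ¬ P v x) h.not).not.congr fun _ => by simp

theorem DefPred.exists_vec {n : ℕ} {P : (α → ℝ) → E n → Prop}
    (h : DefPred L fun w : α ⊕ Fin n → ℝ =>
      P (fun a => w (.inl a)) (WithLp.toLp 2 fun b => w (.inr b))) :
    DefPred L fun v => ∃ x, P v x :=
  (DefPred.exists_block (P := fun v (z : Fin n → ℝ) => P v (WithLp.toLp 2 z)) h).congr fun _ =>
    ⟨fun ⟨_, hz⟩ => ⟨_, hz⟩, fun ⟨x, hx⟩ => ⟨x.ofLp, hx⟩⟩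

theorem DefPred.forall_vec {n : ℕ} {P : (α → ℝ) → E n → Prop}
    (h : DefPred L fun w : α ⊕ Fin n → ℝ =>
      P (fun a => w (.inl a)) (WithLp.toLp 2 fun b => w (.inr b))) :
    DefPred L fun v => ∀ x, P v x :=
  (DefPred.exists_vec (P := fun v x => ¬ P v x) h.not).not.congr fun _ => by simp

theorem IsOMinimal.add (hL : IsOMinimal L) {f g : (α → ℝ) → ℝ} (hf : DefFun L f)
    (hg : DefFun L g) : DefFun L fun w => f w + g w := by
  have h : DefFun L fun w : Fin 2 → ℝ => w 0 + w 1 := by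
    refine DefFun.of_graph (DefPred.comp (P := fun w : Fin 3 → ℝ => w 0 + w 1 = w 2)
      hL.add_definable (F := fun w => ![w (some 0), w (some 1), w none]) fun b => ?_)
    fin_cases b <;> exact DefFun.coord _
  refine h.comp (F := fun w => ![f w, g w]) fun b => ?_
  fin_cases b
  exacts [hf, hg]

theorem IsOMinimal.mul (hL : IsOMinimal L) {f g : (α → ℝ) → ℝ} (hf : DefFun L f)
    (hg : DefFun L g) : DefFun L fun w => f w * g w := by
  have h : DefFun L fun w : Fin 2 → ℝ => w 0 * w 1 := by
    refine DefFun.of_graph (DefPred.comp (P := fun w : Fin 3 → ℝ => w 0 * w 1 = w 2)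
      hL.mul_definable (F := fun w => ![w (some 0), w (some 1), w none]) fun b => ?_)
    fin_cases b <;> exact DefFun.coord _
  refine h.comp (F := fun w => ![f w, g w]) fun b => ?_
  fin_cases b
  exacts [hf, hg]

theorem IsOMinimal.neg (hL : IsOMinimal L) {f : (α → ℝ) → ℝ} (hf : DefFun L f) :
    DefFun L fun w => - f w := by
  simpa using hL.mul (DefFun.const (-1)) hf

theorem IsOMinimal.sub (hL : IsOMinimal L) {f g : (α → ℝ) → ℝ} (hf : DefFun L f)
    (hg : DefFun L g) : DefFun L fun w => f w - g w := by
  simpa [sub_eq_add_neg] using hL.add hf (hL.neg hg)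

theorem IsOMinimal.le (hL : IsOMinimal L) {f g : (α → ℝ) → ℝ} (hf : DefFun L f)
    (hg : DefFun L g) : DefPred L fun w => f w ≤ g w := by
  have h : DefPred L fun w : Fin 2 → ℝ => w 0 ≤ w 1 := by
    -- The order comes from the field structure: nonnegative numbers are the squares.
    refine (DefPred.exists_real (P := fun w z => w 0 + z * z = w 1)
      ((hL.add (.coord _) (hL.mul (.coord _) (.coord _))).eq (.coord _))).congr fun w => ?_
    constructor
    · rintro ⟨z, hz⟩
      nlinarith
    · intro h
      exact ⟨√(w 1 - w 0), by rw [Real.mul_self_sqrt (by linarith)]; ring⟩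
  refine h.comp (F := fun w => ![f w, g w]) fun b => ?_
  fin_cases b
  exacts [hf, hg]

theorem IsOMinimal.lt (hL : IsOMinimal L) {f g : (α → ℝ) → ℝ} (hf : DefFun L f)
    (hg : DefFun L g) : DefPred L fun w => f w < g w :=
  (hL.le hg hf).not.congr fun _ => not_le

theorem IsOMinimal.inv (hL : IsOMinimal L) {f : (α → ℝ) → ℝ} (hf : DefFun L f) :
    DefFun L fun w => (f w)⁻¹ := by
  have h : DefFun L fun w : Fin 1 → ℝ => (w 0)⁻¹ := by
    -- The second alternative records the convention that the inverse of `0` is `0`.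
    refine DefFun.of_graph (DefPred.congr
      (((hL.mul (.coord (some 0)) (.coord none)).eq (.const 1)).or
        (((DefFun.coord (some 0)).eq (.const 0)).and ((DefFun.coord none).eq (.const 0))))
      fun w => ?_)
    constructor
    · rintro (h | ⟨h, h'⟩)
      · exact inv_eq_of_mul_eq_one_right h
      · simp [h, h']
    · rintro h
      by_cases h0 : w (some 0) = 0
      · right; exact ⟨h0, by simpa [h0] using h.symm⟩
      · left; rw [← h]; exact mul_inv_cancel₀ h0
  exact h.comp (F := fun w _ => f w) fun _ => hf

theorem IsOMinimal.sqrt (hL : IsOMinimal L) {f : (α → ℝ) → ℝ} (hf : DefFun L f) :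
    DefFun L fun w => √(f w) := by
  have h : DefFun L fun w : Fin 1 → ℝ => √(w 0) := by
    -- The second alternative records the convention that `√` vanishes on negative numbers.
    refine DefFun.of_graph (DefPred.congr
      (((hL.le (.const 0) (.coord none)).and
          ((hL.mul (.coord none) (.coord none)).eq (.coord (some 0)))).or
        ((hL.lt (.coord (some 0)) (.const 0)).and ((DefFun.coord none).eq (.const 0))))
      fun w => ?_)
    constructor
    · rintro (⟨h, h'⟩ | ⟨h, h'⟩)
      · change √(w (some 0)) = w none
        rw [← h', Real.sqrt_mul_self h]
      · change √(w (some 0)) = w none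
        rw [h', Real.sqrt_eq_zero_of_nonpos h.le]
    · rintro h
      rcases lt_or_ge (w (some 0)) 0 with h0 | h0
      · right; exact ⟨h0, by rw [← h, Real.sqrt_eq_zero_of_nonpos h0.le]⟩
      · left; rw [← h]; exact ⟨Real.sqrt_nonneg _, Real.mul_self_sqrt h0⟩
  exact h.comp (F := fun w _ => f w) fun _ => hf

theorem IsOMinimal.sum (hL : IsOMinimal L) {ι : Type} (s : Finset ι) {f : ι → (α → ℝ) → ℝ}
    (hf : ∀ i, DefFun L (f i)) : DefFun L fun w => ∑ i ∈ s, f i w := by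
  classical
  induction s using Finset.induction_on with
  | empty => simpa using DefFun.const 0
  | insert a s ha ih => simpa [Finset.sum_insert ha] using hL.add (hf a) ih

/-- A vector valued function is definable if its coordinates are. -/
def DefVec (L : FirstOrder.Language.{u, v}) [L.Structure ℝ] {n : ℕ} (f : (α → ℝ) → E n) : Prop :=
  ∀ i, DefFun L fun w => f w i

variable {n : ℕ}

theorem DefVec.tuple (c : Fin n → α) : DefVec L fun w : α → ℝ => WithLp.toLp 2 fun i => w (c i) :=
  fun i => DefFun.coord (c i)

theorem DefVec.const (c : E n) : DefVec L fun _ : α → ℝ => c :=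
  fun i => DefFun.const (c i)

theorem DefVec.comp [Finite β] {f : (β → ℝ) → E n} (hf : DefVec L f)
    {F : (α → ℝ) → β → ℝ} (hF : ∀ b, DefFun L fun v => F v b) : DefVec L fun v => f (F v) :=
  fun i => (hf i).comp hF

theorem IsOMinimal.vec_add (hL : IsOMinimal L) {f g : (α → ℝ) → E n} (hf : DefVec L f)
    (hg : DefVec L g) : DefVec L fun w => f w + g w :=
  fun i => hL.add (hf i) (hg i)

theorem IsOMinimal.vec_sub (hL : IsOMinimal L) {f g : (α → ℝ) → E n} (hf : DefVec L f)
    (hg : DefVec L g) : DefVec L fun w => f w - g w :=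
  fun i => hL.sub (hf i) (hg i)

theorem IsOMinimal.vec_smul (hL : IsOMinimal L) {c : (α → ℝ) → ℝ} {f : (α → ℝ) → E n}
    (hc : DefFun L c) (hf : DefVec L f) : DefVec L fun w => c w • f w :=
  fun i => hL.mul hc (hf i)

theorem IsOMinimal.defFun_inner (hL : IsOMinimal L) {f g : (α → ℝ) → E n} (hf : DefVec L f)
    (hg : DefVec L g) : DefFun L fun w => inner ℝ (f w) (g w) := by
  simpa [PiLp.inner_apply] using hL.sum Finset.univ fun i => hL.mul (hg i) (hf i)

theorem IsOMinimal.defFun_norm (hL : IsOMinimal L) {f : (α → ℝ) → E n} (hf : DefVec L f) :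
    DefFun L fun w => ‖f w‖ := by
  simpa [EuclideanSpace.norm_eq, sq] using
    hL.sqrt (hL.sum Finset.univ fun i => hL.mul (hf i) (hf i))

theorem IsDefinable.mem {X : Set (E n)} (hX : IsDefinable L X) {f : (α → ℝ) → E n}
    (hf : DefVec L f) : DefPred L fun w => f w ∈ X :=
  DefPred.comp (P := fun w : Fin n → ℝ => WithLp.toLp 2 w ∈ X) hX
    (F := fun w i => f w i) fun i => hf i

end Definability

/-! ### Definable choice and the monotonicity theorem -/

section Choice

variable {L : FirstOrder.Language.{u, v}} [L.Structure ℝ] {α β γ : Type}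

/-- Substitution into a relation between two blocks of variables; quantifier elimination into blocks
always produces goals of this shape. -/
theorem DefPred.rel [Finite α] [Finite β] {S : (α → ℝ) → (β → ℝ) → Prop}
    (hS : DefPred L fun w : α ⊕ β → ℝ => S (fun a => w (.inl a)) (fun b => w (.inr b)))
    {f : (γ → ℝ) → α → ℝ} {g : (γ → ℝ) → β → ℝ} (hf : ∀ a, DefFun L fun v => f v a)
    (hg : ∀ b, DefFun L fun v => g v b) : DefPred L fun v => S (f v) (g v) := by
  refine DefPred.comp (P := fun w : α ⊕ β → ℝ => S (fun a => w (.inl a)) (fun b => w (.inr b)))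
    hS (F := fun v => Sum.elim (f v) (g v)) ?_
  rintro (a | b)
  exacts [hf a, hg b]

theorem DefPred.rel_real [Finite α] {S : (α → ℝ) → ℝ → Prop}
    (hS : DefPred L fun w : α ⊕ Fin 1 → ℝ => S (fun a => w (.inl a)) (w (.inr 0)))
    {f : (γ → ℝ) → α → ℝ} {g : (γ → ℝ) → ℝ} (hf : ∀ a, DefFun L fun v => f v a)
    (hg : DefFun L g) : DefPred L fun v => S (f v) (g v) :=
  DefPred.rel (S := fun v (z : Fin 1 → ℝ) => S v (z 0)) hS (g := fun v _ => g v) hf fun _ => hg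

/-- Being the greatest lower bound is a first-order condition, so the graph is definable. -/
theorem IsOMinimal.defFun_sInf (hL : IsOMinimal L) [Finite α] {S : (α → ℝ) → ℝ → Prop}
    (hS : DefPred L fun w : α ⊕ Fin 1 → ℝ => S (fun a => w (.inl a)) (w (.inr 0)))
    (hne : ∀ v, ∃ z, S v z) (hbdd : ∀ v, BddBelow {z | S v z}) :
    DefFun L fun v => sInf {z | S v z} := by
  refine DefFun.of_graph (DefPred.congr (P := fun w : Option α → ℝ =>
    (∀ z, S (fun a => w (some a)) z → w none ≤ z) ∧
      ∀ b, (∀ z, S (fun a => w (some a)) z → b ≤ z) → b ≤ w none) ?_ fun w => ?_)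
  · refine .and (.forall_real (.imp (.rel_real hS (fun a => .coord _) (.coord _))
      (hL.le (.coord _) (.coord _)))) (.forall_real (.imp (.forall_real (.imp
        (.rel_real hS (fun a => .coord _) (.coord _)) (hL.le (.coord _) (.coord _)))) ?_))
    exact hL.le (.coord _) (.coord _)
  · have h : IsGLB {z | S (fun a => w (some a)) z} _ :=
      isGLB_csInf (hne fun a => w (some a)) (hbdd fun a => w (some a))
    constructor
    · intro h'
      exact h.unique ⟨fun z hz => h'.1 z hz, fun b hb => h'.2 b fun z hz => hb hz⟩
    · intro h'
      rw [h'] at h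
      exact ⟨fun z hz => h.1 hz, fun b hb => h.2 fun z hz => hb z hz⟩

theorem IsOMinimal.defFun_sSup (hL : IsOMinimal L) [Finite α] {S : (α → ℝ) → ℝ → Prop}
    (hS : DefPred L fun w : α ⊕ Fin 1 → ℝ => S (fun a => w (.inl a)) (w (.inr 0)))
    (hne : ∀ v, ∃ z, S v z) (hbdd : ∀ v, BddAbove {z | S v z}) :
    DefFun L fun v => sSup {z | S v z} := by
  have h := hL.neg (hL.defFun_sInf (S := fun v z => S v (-z))
    (.rel_real hS (fun a => .coord _) (hL.neg (.coord _)))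
    (fun v => (hne v).imp' (fun z => -z) fun z hz => by simpa using hz)
    (fun v => by
      obtain ⟨b, hb⟩ := hbdd v
      exact ⟨-b, fun z hz => by have := hb hz; linarith⟩))
  have h2 : ∀ v, -sInf {z | S v (-z)} = sSup {z | S v z} := fun v => by
    have : {z | S v (-z)} = -{z | S v z} := rfl
    rw [this, Real.sInf_neg, neg_neg]
  simpa only [h2] using h

/-- Among finitely many intervals, either one accumulates at `a` from the right, and then by
order-connectedness contains some `(a, b)`, or all of them miss a right neighbourhood of `a`. This
dichotomy is how o-minimality enters most arguments below. -/
theorem IsOMinimal.eventually_gt_or (hL : IsOMinimal L) {P : ℝ → Prop}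
    (hP : DefPred L fun w : Fin 1 → ℝ => P (w 0)) (a : ℝ) :
    (∀ᶠ t in 𝓝[>] a, P t) ∨ ∀ᶠ t in 𝓝[>] a, ¬ P t := by
  obtain ⟨F, hF, hI, hPF⟩ := hL.finite_union_intervals {t | P t} hP
  have hPF' : ∀ t, P t ↔ ∃ I ∈ F, t ∈ I := fun t => by
    have := Set.ext_iff.1 hPF t
    simpa using this
  by_cases h : ∃ I ∈ F, ∃ᶠ t in 𝓝[>] a, t ∈ I
  · left
    obtain ⟨I, hIF, hfr⟩ := h
    obtain ⟨b, hbI, hab⟩ := (hfr.and_eventually self_mem_nhdsWithin).exists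
    filter_upwards [Ioo_mem_nhdsGT hab] with t ht
    obtain ⟨c, hcI, hc⟩ := (hfr.and_eventually (Ioo_mem_nhdsGT ht.1)).exists
    exact (hPF' t).2 ⟨I, hIF, (hI I hIF).out hcI hbI ⟨hc.2.le, ht.2.le⟩⟩
  · right
    push Not at h
    filter_upwards [(hF.eventually_all).2 h] with t ht hPt
    obtain ⟨I, hIF, htI⟩ := (hPF' t).1 hPt
    exact ht I hIF htI

theorem IsOMinimal.eventually_lt_or (hL : IsOMinimal L) {P : ℝ → Prop}
    (hP : DefPred L fun w : Fin 1 → ℝ => P (w 0)) (a : ℝ) :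
    (∀ᶠ t in 𝓝[<] a, P t) ∨ ∀ᶠ t in 𝓝[<] a, ¬ P t := by
  have h := hL.eventually_gt_or (P := fun t => P (-t))
    (DefPred.comp (P := fun w : Fin 1 → ℝ => P (w 0)) hP (F := fun w _ => -(w 0))
      fun _ => hL.neg (.coord _)) (-a)
  have ht : Tendsto (fun t : ℝ => -t) (𝓝[<] a) (𝓝[>] (-a)) := tendsto_neg_nhdsLT
  rcases h with h | h
  · left; simpa using ht.eventually h
  · right; simpa using ht.eventually h

/-- Definable choice of a real number in a uniformly bounded family. -/
theorem IsOMinimal.exists_choice_real (hL : IsOMinimal L) [Finite α] {S : (α → ℝ) → ℝ → Prop}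
    (hS : DefPred L fun w : α ⊕ Fin 1 → ℝ => S (fun a => w (.inl a)) (w (.inr 0)))
    (hne : ∀ v, ∃ z, S v z) {M : ℝ} (hM : ∀ v z, S v z → |z| ≤ M) :
    ∃ g : (α → ℝ) → ℝ, DefFun L g ∧ ∀ v, S v (g v) := by
  classical
  have hbelow : ∀ v, BddBelow {z | S v z} := fun v => ⟨-M, fun z hz => (abs_le.1 (hM v z hz)).1⟩
  set a : (α → ℝ) → ℝ := fun v => sInf {z | S v z}
  have ha : DefFun L a := hL.defFun_sInf hS hne hbelow
  have haM : ∀ v, a v ≤ M := fun v => by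
    obtain ⟨z, hz⟩ := hne v
    exact (csInf_le (hbelow v) hz).trans (abs_le.1 (hM v z hz)).2
  -- The chosen point is the infimum `a` if it belongs to the fibre, and otherwise the midpoint of
  -- the longest interval `(a, b)` starting at `a` and contained in the fibre below `M`.
  set B : (α → ℝ) → ℝ → Prop := fun v s => a v ≤ s ∧ s ≤ M ∧ ∀ r, a v < r → r < s → S v r
  have hBdef : DefPred L fun w : α ⊕ Fin 1 → ℝ => B (fun a => w (.inl a)) (w (.inr 0)) := by
    refine .and (hL.le (ha.comp fun a => .coord _) (.coord _)) (.and (hL.le (.coord _) (.const _))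
      (.forall_real (.imp (hL.lt (ha.comp fun a => .coord _) (.coord _)) (.imp
        (hL.lt (.coord _) (.coord _)) ?_))))
    exact .rel_real hS (fun a => .coord _) (.coord _)
  have hBne : ∀ v, ∃ s, B v s := fun v =>
    ⟨a v, le_rfl, haM v, fun r h1 h2 => absurd h1 h2.not_gt⟩
  have hBbdd : ∀ v, BddAbove {s | B v s} := fun v => ⟨M, fun s hs => hs.2.1⟩
  set b : (α → ℝ) → ℝ := fun v => sSup {s | B v s}
  have hb : DefFun L b := hL.defFun_sSup hBdef hBne hBbdd
  refine ⟨fun v => if S v (a v) then a v else (a v + b v) * 2⁻¹,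
    .ite (.rel_real hS (fun a => .coord _) ha) ha (hL.mul (hL.add ha hb) (.const _)), fun v => ?_⟩
  by_cases h : S v (a v)
  · simp [h]
  simp only [h, if_false]
  have hfr : ∀ c > a v, ∃ z, S v z ∧ a v < z ∧ z < c := fun c hc => by
    obtain ⟨z, hz, hzc⟩ := exists_lt_of_csInf_lt (show {z | S v z}.Nonempty from hne v) hc
    refine ⟨z, hz, lt_of_le_of_ne (csInf_le (hbelow v) hz) ?_, hzc⟩
    rintro rfl
    exact h hz
  -- The interval is nondegenerate: the fibre accumulates at its infimum from the right, so by the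
  -- dichotomy it contains an interval there.
  obtain ⟨s, has, hs⟩ : ∃ s > a v, B v s := by
    rcases hL.eventually_gt_or (P := S v)
      (.rel_real hS (f := fun _ => v) (fun _ => .const _) (.coord _)) (a v) with h' | h'
    · obtain ⟨c, hc, hcS⟩ := (mem_nhdsGT_iff_exists_Ioo_subset).1 h'
      obtain ⟨z, hz, haz, -⟩ := hfr c hc
      have hzM := (abs_le.1 (hM v z hz)).2
      refine ⟨min c M, lt_min hc (haz.trans_le hzM),
        le_min (mem_Ioi.1 hc).le (haz.le.trans hzM), min_le_right _ _, fun r h1 h2 => ?_⟩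
      exact hcS ⟨h1, h2.trans_le (min_le_left _ _)⟩
    · obtain ⟨c, hc, hcS⟩ := (mem_nhdsGT_iff_exists_Ioo_subset).1 h'
      obtain ⟨z, hz, haz, hzc⟩ := hfr c hc
      exact absurd hz (hcS ⟨haz, hzc⟩)
  have hsb : s ≤ b v := le_csSup (hBbdd v) hs
  obtain ⟨s', hs', hlt⟩ := exists_lt_of_lt_csSup (show {s | B v s}.Nonempty from hBne v)
    (show (a v + b v) * 2⁻¹ < b v by linarith)
  exact hs'.2.2 _ (by linarith) hlt

/-- Definable choice of a tuple of real numbers in a uniformly bounded family. -/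
theorem IsOMinimal.exists_choice (hL : IsOMinimal L) [Finite α] (β : Type) [Finite β] {M : ℝ} :
    ∀ S : (α → ℝ) → (β → ℝ) → Prop,
      DefPred L (fun w : α ⊕ β → ℝ => S (fun a => w (.inl a)) (fun b => w (.inr b))) →
      (∀ v, ∃ z, S v z) → (∀ v z, S v z → ∀ b, |z b| ≤ M) →
      ∃ g : (α → ℝ) → β → ℝ, (∀ b, DefFun L fun v => g v b) ∧ ∀ v, S v (g v) := by
  suffices h : Finite β → ∀ S : (α → ℝ) → (β → ℝ) → Prop,
      DefPred L (fun w : α ⊕ β → ℝ => S (fun a => w (.inl a)) (fun b => w (.inr b))) →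
      (∀ v, ∃ z, S v z) → (∀ v z, S v z → ∀ b, |z b| ≤ M) →
      ∃ g : (α → ℝ) → β → ℝ, (∀ b, DefFun L fun v => g v b) ∧ ∀ v, S v (g v) from
    h inferInstance
  induction β using Finite.induction_empty_option with
  | of_equiv e ih =>
    intro hfin S hS hne hM
    obtain ⟨g, hg, hgS⟩ := ih (.of_equiv _ e.symm) (fun v z => S v (fun b => z (e.symm b)))
      (.rel hS (fun a => .coord _) fun b => .coord _)
      (fun v => (hne v).imp' (fun z a => z (e a)) fun z hz => by simpa using hz)
      (fun v z hz b => by simpa using hM v _ hz (e b))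
    exact ⟨fun v b => g v (e.symm b), fun b => hg _, hgS⟩
  | h_empty =>
    intro _ S hS hne hM
    refine ⟨fun _ b => b.elim, fun b => b.elim, fun v => ?_⟩
    obtain ⟨z, hz⟩ := hne v
    convert hz using 1
    exact Subsingleton.elim _ _
  | h_option ih =>
    rename_i δ _
    intro _ S hS hne hM
    -- One coordinate is chosen in the projection of the fibre, the others in the slice over it.
    obtain ⟨g, hg, hgS⟩ := hL.exists_choice_real (M := M)
      (S := fun v x => ∃ z : δ → ℝ, S v (fun o => o.elim x z))
      (.exists_block (.rel hS (fun a => .coord _) fun b => by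
        cases b <;> exact .coord _))
      (fun v => by
        obtain ⟨z, hz⟩ := hne v
        refine ⟨z none, fun d => z (some d), ?_⟩
        convert hz with o
        cases o <;> rfl)
      (fun v x ⟨z, hz⟩ => hM v _ hz none)
    obtain ⟨k, hk, hkS⟩ := ih inferInstance (fun v z => S v (fun o => o.elim (g v) z))
      (.rel hS (fun a => .coord _) fun b => by
        cases b
        · exact hg.comp fun a => .coord _
        · exact .coord _)
      hgS (fun v z hz b => hM v _ hz (some b))
    refine ⟨fun v o => o.elim (g v) (k v), fun b => ?_, hkS⟩
    cases b
    exacts [hg, hk _]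

end Choice

/-! ### Monotonicity of one-variable definable germs and comparison of their derivatives. -/

section Monotonicity

variable {L : FirstOrder.Language.{u, v}} [L.Structure ℝ] {α : Type}

/-- A definable real function of one real variable. -/
def DefCurve (L : FirstOrder.Language.{u, v}) [L.Structure ℝ] (F : ℝ → ℝ) : Prop :=
  DefFun L fun w : Fin 1 → ℝ => F (w 0)

theorem DefCurve.comp {F : ℝ → ℝ} (hF : DefCurve L F) {f : (α → ℝ) → ℝ} (hf : DefFun L f) :
    DefFun L fun w => F (f w) :=
  DefFun.comp (f := fun w : Fin 1 → ℝ => F (w 0)) hF (F := fun w _ => f w) fun _ => hf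

/-- No continuity is assumed: the supremum of the points up to which `F` stays above `F x` is
reached by the condition on the left and passed by the condition on the right. -/
theorem monotoneOn_of_local {F : ℝ → ℝ} {a b : ℝ}
    (hr : ∀ t ∈ Ioo a b, ∀ᶠ s in 𝓝[>] t, F t ≤ F s)
    (hl : ∀ t ∈ Ioo a b, ∀ᶠ s in 𝓝[<] t, F s ≤ F t) : MonotoneOn F (Ioo a b) := by
  intro x hx y hy hxy
  set A : Set ℝ := {s | s ∈ Icc x y ∧ ∀ r ∈ Icc x s, F x ≤ F r}
  have hxA : x ∈ A := ⟨⟨le_rfl, hxy⟩, fun r hr => by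
    rw [le_antisymm hr.2 hr.1]⟩
  have hAb : BddAbove A := ⟨y, fun s hs => hs.1.2⟩
  set c := sSup A
  have hxc : x ≤ c := le_csSup hAb hxA
  have hcy : c ≤ y := csSup_le ⟨x, hxA⟩ fun s hs => hs.1.2
  have hlt : ∀ r, x ≤ r → r < c → F x ≤ F r := fun r hxr hrc => by
    obtain ⟨s, hs, hrs⟩ := exists_lt_of_lt_csSup ⟨x, hxA⟩ hrc
    exact hs.2 r ⟨hxr, hrs.le⟩
  have hc : c ∈ Ioo a b := ⟨hx.1.trans_le hxc, hcy.trans_lt hy.2⟩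
  have hxFc : F x ≤ F c := by
    rcases hxc.eq_or_lt with h | h
    · rw [← h]
    · obtain ⟨r, hr1, hr2⟩ := ((hl c hc).and (Ioo_mem_nhdsLT h)).exists
      exact (hlt r hr2.1.le hr2.2).trans hr1
  rcases hcy.eq_or_lt with h | h
  · rwa [← h]
  · exfalso
    obtain ⟨d, hd, hdF⟩ := (mem_nhdsGT_iff_exists_Ioo_subset).1
      ((hr c hc).and (Ioo_mem_nhdsGT h))
    have hm : (c + d) / 2 ∈ Ioo c d := ⟨by linarith [mem_Ioi.1 hd], by linarith [mem_Ioi.1 hd]⟩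
    have : (c + d) / 2 ∈ A := by
      refine ⟨⟨hxc.trans hm.1.le, (hdF hm).2.2.le⟩, fun r hr => ?_⟩
      rcases lt_trichotomy r c with h' | h' | h'
      · exact hlt r hr.1 h'
      · rwa [h']
      · exact hxFc.trans (hdF ⟨h', hr.2.trans_lt hm.2⟩).1
    exact absurd (le_csSup hAb this) (not_le.2 hm.1)

/-- A function takes only countably many values at local minima. -/
theorem countable_image_of_local_min {F : ℝ → ℝ} {A : Set ℝ}
    (h : ∀ t ∈ A, ∀ᶠ s in 𝓝 t, F t ≤ F s) : (F '' A).Countable := by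
  -- Two minima witnessed by the same rational interval have the same value.
  have hq : ∀ t ∈ A, ∃ q : ℚ × ℚ, (q.1 : ℝ) < t ∧ t < q.2 ∧ ∀ s, (q.1 : ℝ) < s → s < q.2 →
      F t ≤ F s := fun t ht => by
    obtain ⟨l, r, htlr, hlr⟩ := mem_nhds_iff_exists_Ioo_subset.1 (h t ht)
    obtain ⟨q₁, h1, h1'⟩ := exists_rat_btwn htlr.1
    obtain ⟨q₂, h2, h2'⟩ := exists_rat_btwn htlr.2
    exact ⟨(q₁, q₂), h1', h2, fun s hs1 hs2 => hlr ⟨h1.trans hs1, hs2.trans h2'⟩⟩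
  choose! q hq1 hq2 hq3 using hq
  have key : ∀ t ∈ A, ∀ t' ∈ A, q t = q t' → F t ≤ F t' := fun t ht t' ht' heq =>
    hq3 t ht t' (by rw [heq]; exact hq1 t' ht') (by rw [heq]; exact hq2 t' ht')
  have hc : (q '' A).Countable := Set.to_countable _
  choose! g hg using fun y (hy : y ∈ q '' A) => hy
  refine (hc.image fun y => F (g y)).mono ?_
  rintro _ ⟨t, ht, rfl⟩
  obtain ⟨h1, h2⟩ := hg (q t) ⟨t, ht, rfl⟩
  exact ⟨q t, ⟨t, ht, rfl⟩, le_antisymm (key _ h1 _ ht h2) (key _ ht _ h1 h2.symm)⟩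

theorem defPred_eventually_gt (hL : IsOMinimal L) {R : ℝ → ℝ → Prop}
    (hR : DefPred L fun w : Fin 2 → ℝ => R (w 0) (w 1)) :
    DefPred L fun w : Fin 1 → ℝ => ∀ᶠ s in 𝓝[>] (w 0), R (w 0) s := by
  refine DefPred.congr (P := fun w : Fin 1 → ℝ => ∃ r, w 0 < r ∧ ∀ s, w 0 < s → s < r → R (w 0) s)
    (.exists_real (.and (hL.lt (.coord _) (.coord _)) (.forall_real (.imp
      (hL.lt (.coord _) (.coord _)) (.imp (hL.lt (.coord _) (.coord _)) ?_))))) fun w => ?_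
  · refine DefPred.comp hR (F := fun w : (Fin 1 ⊕ Fin 1) ⊕ Fin 1 → ℝ =>
      ![w (.inl (.inl 0)), w (.inr 0)]) fun b => ?_
    fin_cases b <;> exact .coord _
  · refine Iff.trans ?_ (mem_nhdsGT_iff_exists_Ioo_subset).symm
    exact ⟨fun ⟨r, h1, h2⟩ => ⟨r, h1, fun s hs => h2 s hs.1 hs.2⟩,
      fun ⟨r, h1, h2⟩ => ⟨r, h1, fun s h3 h4 => h2 ⟨h3, h4⟩⟩⟩

theorem defPred_eventually_lt (hL : IsOMinimal L) {R : ℝ → ℝ → Prop}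
    (hR : DefPred L fun w : Fin 2 → ℝ => R (w 0) (w 1)) :
    DefPred L fun w : Fin 1 → ℝ => ∀ᶠ s in 𝓝[<] (w 0), R (w 0) s := by
  refine DefPred.congr (P := fun w : Fin 1 → ℝ => ∃ r, r < w 0 ∧ ∀ s, r < s → s < w 0 → R (w 0) s)
    (.exists_real (.and (hL.lt (.coord _) (.coord _)) (.forall_real (.imp
      (hL.lt (.coord _) (.coord _)) (.imp (hL.lt (.coord _) (.coord _)) ?_))))) fun w => ?_
  · refine DefPred.comp hR (F := fun w : (Fin 1 ⊕ Fin 1) ⊕ Fin 1 → ℝ =>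
      ![w (.inl (.inl 0)), w (.inr 0)]) fun b => ?_
    fin_cases b <;> exact .coord _
  · refine Iff.trans ?_ (mem_nhdsLT_iff_exists_Ioo_subset).symm
    exact ⟨fun ⟨r, h1, h2⟩ => ⟨r, h1, fun s hs => h2 s hs.1 hs.2⟩,
      fun ⟨r, h1, h2⟩ => ⟨r, h1, fun s h3 h4 => h2 ⟨h3, h4⟩⟩⟩

theorem exists_monotoneOn_of_eventually_local {F : ℝ → ℝ}
    (hr : ∀ᶠ t in 𝓝[>] (0 : ℝ), ∀ᶠ s in 𝓝[>] t, F t ≤ F s)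
    (hl : ∀ᶠ t in 𝓝[>] (0 : ℝ), ∀ᶠ s in 𝓝[<] t, F s ≤ F t) :
    ∃ δ > 0, MonotoneOn F (Ioo 0 δ) := by
  obtain ⟨δ, hδ, h⟩ := (mem_nhdsGT_iff_exists_Ioo_subset).1 (hr.and hl)
  exact ⟨δ, hδ, monotoneOn_of_local (fun t ht => (h ht).1) fun t ht => (h ht).2⟩

/-- Such an `F` is locally constant near `0`. Otherwise no level set contains an interval there, so
level sets are countable; the values at local minima are countable too, and a whole interval would
be countable. -/
theorem IsOMinimal.exists_monotoneOn_of_local_min (hL : IsOMinimal L) {F : ℝ → ℝ}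
    (hF : DefCurve L F) (hr : ∀ᶠ t in 𝓝[>] (0 : ℝ), ∀ᶠ s in 𝓝[>] t, F t ≤ F s)
    (hl : ∀ᶠ t in 𝓝[>] (0 : ℝ), ∀ᶠ s in 𝓝[<] t, F t ≤ F s) :
    ∃ δ > 0, MonotoneOn F (Ioo 0 δ) := by
  have hEq : DefPred L fun w : Fin 2 → ℝ => F (w 1) = F (w 0) :=
    (hF.comp (.coord 1)).eq (hF.comp (.coord 0))
  have hK := (defPred_eventually_gt hL (R := fun x y => F y = F x) hEq).and
    (defPred_eventually_lt hL (R := fun x y => F y = F x) hEq)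
  rcases hL.eventually_gt_or (P := fun t => (∀ᶠ s in 𝓝[>] t, F s = F t) ∧
    ∀ᶠ s in 𝓝[<] t, F s = F t) hK 0 with h | h
  · exact exists_monotoneOn_of_eventually_local
      (h.mono fun t ht => ht.1.mono fun s hs => hs.ge)
      (h.mono fun t ht => ht.2.mono fun s hs => hs.le)
  exfalso
  obtain ⟨δ, hδ, hsub⟩ := (mem_nhdsGT_iff_exists_Ioo_subset).1 ((hr.and hl).and h)
  have hcount : (F '' Ioo 0 δ).Countable := countable_image_of_local_min fun t ht => by
    rw [← nhdsNE_sup_pure, ← nhdsLT_sup_nhdsGT]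
    simp only [eventually_sup, eventually_pure, le_refl, and_true]
    exact ⟨(hsub ht).1.2, (hsub ht).1.1⟩
  have hlevel : ∀ c, {t ∈ Ioo 0 δ | F t = c}.Countable := fun c => by
    obtain ⟨G, hG, hI, hcG⟩ := hL.finite_union_intervals {t | F t = c}
      ((hF.comp (.coord 0)).eq (.const c) : DefPred L fun w : Fin 1 → ℝ => F (w 0) = c)
    have hsubset : {t ∈ Ioo 0 δ | F t = c} ⊆ ⋃ I ∈ G, I ∩ Ioo 0 δ := fun t ht => by
      have : t ∈ ⋃₀ G := hcG ▸ ht.2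
      obtain ⟨I, hIG, htI⟩ := this
      exact mem_biUnion hIG ⟨htI, ht.1⟩
    refine (hG.countable.biUnion fun I hIG => ?_).mono hsubset
    refine Set.Subsingleton.countable fun x hx y hy => ?_
    by_contra hxy
    wlog hlt : x < y generalizing x y
    · exact this y hy x hx (Ne.symm hxy) (lt_of_le_of_ne (not_lt.1 hlt) (Ne.symm hxy))
    have hconst : ∀ s ∈ Icc x y, F s = c := fun s hs => by
      have : s ∈ {t | F t = c} := by
        rw [hcG]; exact ⟨I, hIG, (hI I hIG).out hx.1 hy.1 hs⟩
      exact this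
    obtain ⟨z, hz⟩ := exists_between hlt
    refine (hsub ⟨hx.2.1.trans hz.1, hz.2.trans hy.2.2⟩).2 ?_
    have : ∀ᶠ s in 𝓝 z, F s = F z := by
      filter_upwards [Ioo_mem_nhds hz.1 hz.2] with s hs
      rw [hconst s ⟨hs.1.le, hs.2.le⟩, hconst z ⟨hz.1.le, hz.2.le⟩]
    exact ⟨this.filter_mono nhdsWithin_le_nhds, this.filter_mono nhdsWithin_le_nhds⟩
  have : (Ioo 0 δ).Countable := by
    refine (hcount.biUnion fun c _ => hlevel c).mono fun t ht => ?_
    exact mem_biUnion ⟨t, ht, rfl⟩ ⟨ht, rfl⟩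
  exact absurd this (by rw [Cardinal.Real.Ioo_countable_iff]; exact not_le.2 hδ)

theorem DefCurve.neg (hL : IsOMinimal L) {F : ℝ → ℝ} (hF : DefCurve L F) :
    DefCurve L fun t => -F t :=
  hL.neg hF

/-- The monotonicity theorem, for germs at `0` from the right. -/
theorem IsOMinimal.exists_monotoneOn_or_antitoneOn (hL : IsOMinimal L) {F : ℝ → ℝ}
    (hF : DefCurve L F) : ∃ δ > 0, MonotoneOn F (Ioo 0 δ) ∨ AntitoneOn F (Ioo 0 δ) := by
  have hle : DefPred L fun w : Fin 2 → ℝ => F (w 0) ≤ F (w 1) :=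
    hL.le (hF.comp (.coord 0)) (hF.comp (.coord 1))
  have hpt : ∀ t, DefPred L fun w : Fin 1 → ℝ => F t ≤ F (w 0) := fun t =>
    hL.le (.const _) (hF.comp (.coord 0))
  -- The dichotomy is applied twice: at each `t` to compare with nearby values, then at `0` to make
  -- the outcome uniform in `t`.
  have hright : (∀ᶠ t in 𝓝[>] (0 : ℝ), ∀ᶠ s in 𝓝[>] t, F t ≤ F s) ∨
      ∀ᶠ t in 𝓝[>] (0 : ℝ), ∀ᶠ s in 𝓝[>] t, F s ≤ F t := by
    refine (hL.eventually_gt_or (defPred_eventually_gt hL (R := fun x y => F x ≤ F y) hle)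
      0).imp id fun h => ?_
    filter_upwards [h] with t ht
    exact ((hL.eventually_gt_or (hpt t) t).resolve_left ht).mono fun s hs => (not_le.1 hs).le
  have hleft : (∀ᶠ t in 𝓝[>] (0 : ℝ), ∀ᶠ s in 𝓝[<] t, F t ≤ F s) ∨
      ∀ᶠ t in 𝓝[>] (0 : ℝ), ∀ᶠ s in 𝓝[<] t, F s ≤ F t := by
    refine (hL.eventually_gt_or (defPred_eventually_lt hL (R := fun x y => F x ≤ F y) hle)
      0).imp id fun h => ?_
    filter_upwards [h] with t ht
    exact ((hL.eventually_lt_or (hpt t) t).resolve_left ht).mono fun s hs => (not_le.1 hs).le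
  rcases hright with hr | hr <;> rcases hleft with hl | hl
  · exact (hL.exists_monotoneOn_of_local_min hF hr hl).imp fun δ h => ⟨h.1, .inl h.2⟩
  · exact (exists_monotoneOn_of_eventually_local hr hl).imp fun δ h => ⟨h.1, .inl h.2⟩
  · obtain ⟨δ, hδ, h⟩ := exists_monotoneOn_of_eventually_local (F := fun t => -F t)
      (by simpa using hr) (by simpa using hl)
    exact ⟨δ, hδ, .inr fun x hx y hy hxy => neg_le_neg_iff.1 (h hx hy hxy)⟩
  · obtain ⟨δ, hδ, h⟩ := hL.exists_monotoneOn_of_local_min (hF.neg hL)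
      (by simpa using hr) (by simpa using hl)
    exact ⟨δ, hδ, .inr fun x hx y hy hxy => neg_le_neg_iff.1 (h hx hy hxy)⟩

/-- A definable function that is bounded near `0` from the right has a limit there. -/
theorem IsOMinimal.exists_tendsto (hL : IsOMinimal L) {F : ℝ → ℝ} (hF : DefCurve L F) {M : ℝ}
    (hM : ∀ᶠ t in 𝓝[>] (0 : ℝ), |F t| ≤ M) : ∃ c, Tendsto F (𝓝[>] 0) (𝓝 c) := by
  obtain ⟨δ, hδ, h⟩ := hL.exists_monotoneOn_or_antitoneOn hF
  obtain ⟨δ', hδ', h'⟩ := (mem_nhdsGT_iff_exists_Ioo_subset).1 (hM.and (Ioo_mem_nhdsGT hδ))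
  have hne : (Ioo 0 δ').Nonempty := nonempty_Ioo.2 hδ'
  have hss : Ioo 0 δ' ⊆ Ioo 0 δ := fun t ht => (h' ht).2
  have hb : BddBelow (F '' Ioo 0 δ') :=
    ⟨-M, by rintro _ ⟨t, ht, rfl⟩; exact (abs_le.1 (h' ht).1).1⟩
  have ha : BddAbove (F '' Ioo 0 δ') :=
    ⟨M, by rintro _ ⟨t, ht, rfl⟩; exact (abs_le.1 (h' ht).1).2⟩
  rcases h with h | h
  · exact ⟨_, MonotoneOn.tendsto_nhdsWithin_Ioo_right hne (h.mono hss) hb⟩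
  · exact ⟨_, AntitoneOn.tendsto_nhdsWithin_Ioo_right hne (h.mono hss) ha⟩

/-- Finitely many definable functions are simultaneously differentiable at points arbitrarily close
to `0`. -/
theorem IsOMinimal.frequently_differentiableAt (hL : IsOMinimal L) {ι : Type} [Finite ι]
    {F : ι → ℝ → ℝ} (hF : ∀ i, DefCurve L (F i)) :
    ∃ᶠ t in 𝓝[>] (0 : ℝ), ∀ i, DifferentiableAt ℝ (F i) t := by
  have h : ∀ i, ∀ᶠ δ in 𝓝[>] (0 : ℝ), ∀ᵐ t : ℝ, t ∈ Ioo 0 δ → DifferentiableAt ℝ (F i) t := by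
    intro i
    -- Lebesgue: a monotone function is differentiable almost everywhere.
    obtain ⟨δ, hδ, h⟩ := hL.exists_monotoneOn_or_antitoneOn (hF i)
    filter_upwards [Ioo_mem_nhdsGT hδ] with δ' hδ'
    have : ∀ᵐ t : ℝ, t ∈ Ioo 0 δ → DifferentiableAt ℝ (F i) t := by
      rcases h with h | h
      · filter_upwards [h.ae_differentiableWithinAt_of_mem] with t ht hmem
        exact (ht hmem).differentiableAt (Ioo_mem_nhds hmem.1 hmem.2)
      · filter_upwards [h.neg.ae_differentiableWithinAt_of_mem] with t ht hmem
        simpa using ((ht hmem).differentiableAt (Ioo_mem_nhds hmem.1 hmem.2)).neg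
    filter_upwards [this] with t ht hmem using ht ⟨hmem.1, hmem.2.trans hδ'.2⟩
  rw [frequently_iff]
  intro U hU
  obtain ⟨δ₀, hδ₀, hU⟩ := (mem_nhdsGT_iff_exists_Ioo_subset).1 hU
  obtain ⟨δ, hδ, hmem⟩ := ((eventually_all.2 h).and (Ioo_mem_nhdsGT hδ₀)).exists
  have hall : ∀ᵐ t : ℝ, ∀ i, t ∈ Ioo 0 δ → DifferentiableAt ℝ (F i) t :=
    MeasureTheory.ae_all_iff.2 hδ
  obtain ⟨t, ht, htmem⟩ : ∃ t, (∀ i, t ∈ Ioo 0 δ → DifferentiableAt ℝ (F i) t) ∧ t ∈ Ioo 0 δ := by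
    by_contra hcon
    push Not at hcon
    have : MeasureTheory.volume (Ioo (0 : ℝ) δ) = 0 :=
      MeasureTheory.measure_mono_null (fun t ht h' => hcon t h' ht) hall
    simp at this
    linarith [hmem.1]
  exact ⟨t, hU ⟨htmem.1, htmem.2.trans hmem.2⟩, fun i => ht i htmem⟩

/-- The germ is monotone or antitone; if it increases from the limit `0` while staying nonpositive,
it vanishes. So it is antitone in either case. -/
theorem IsOMinimal.eventually_deriv_nonpos (hL : IsOMinimal L) {F : ℝ → ℝ} (hF : DefCurve L F)
    (h0 : Tendsto F (𝓝[>] 0) (𝓝 0)) (hneg : ∀ᶠ t in 𝓝[>] (0 : ℝ), F t ≤ 0) :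
    ∀ᶠ t in 𝓝[>] (0 : ℝ), ∀ F', HasDerivAt F F' t → F' ≤ 0 := by
  obtain ⟨δ, hδ, h⟩ : ∃ δ > 0, AntitoneOn F (Ioo 0 δ) := by
    obtain ⟨δ, hδ, h⟩ := hL.exists_monotoneOn_or_antitoneOn hF
    rcases h with h | h
    · obtain ⟨δ', hδ', h'⟩ := (mem_nhdsGT_iff_exists_Ioo_subset).1 (hneg.and (Ioo_mem_nhdsGT hδ))
      have hz : ∀ t ∈ Ioo 0 δ', F t = 0 := fun t ht => by
        refine le_antisymm (h' ht).1 (le_of_tendsto h0 ?_)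
        filter_upwards [Ioo_mem_nhdsGT ht.1] with s hs
        exact h (h' ⟨hs.1, hs.2.trans ht.2⟩).2 (h' ht).2 hs.2.le
      exact ⟨δ', hδ', fun x hx y hy _ => by rw [hz x hx, hz y hy]⟩
    · exact ⟨δ, hδ, h⟩
  filter_upwards [Ioo_mem_nhdsGT hδ] with t ht F' hF'
  have hnhds := Ioo_mem_nhds ht.1 ht.2
  have := h.derivWithin_nonpos (x := t)
  rwa [derivWithin_of_mem_nhds hnhds, hF'.deriv] at this

/-- A bound between definable germs tending to `0` is inherited by the derivatives. -/
theorem IsOMinimal.eventually_abs_deriv_le (hL : IsOMinimal L) {F G : ℝ → ℝ} (hF : DefCurve L F)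
    (hG : DefCurve L G) (hF0 : Tendsto F (𝓝[>] 0) (𝓝 0)) (hG0 : Tendsto G (𝓝[>] 0) (𝓝 0)) {C : ℝ}
    (hle : ∀ᶠ t in 𝓝[>] (0 : ℝ), |F t| ≤ C * G t) :
    ∀ᶠ t in 𝓝[>] (0 : ℝ), ∀ F' G', HasDerivAt F F' t → HasDerivAt G G' t → |F'| ≤ C * G' := by
  have h1 := hL.eventually_deriv_nonpos (F := fun t => F t - C * G t)
    (hL.sub hF (hL.mul (.const C) hG)) (by simpa using hF0.sub (hG0.const_mul C))
    (hle.mono fun t ht => by linarith [(abs_le.1 ht).2])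
  have h2 := hL.eventually_deriv_nonpos (F := fun t => -F t - C * G t)
    (hL.sub (hL.neg hF) (hL.mul (.const C) hG)) (by simpa using hF0.neg.sub (hG0.const_mul C))
    (hle.mono fun t ht => by linarith [(abs_le.1 ht).1])
  filter_upwards [h1, h2] with t h1 h2 F' G' hF' hG'
  have h1 := h1 _ (hF'.sub (hG'.const_mul C))
  have h2 := h2 _ (hF'.neg.sub (hG'.const_mul C))
  exact abs_le.2 ⟨by linarith, by linarith⟩

/-- The derivative of a positive definable germ of at most linear growth is at least a constant
multiple of its slope. -/
theorem IsOMinimal.exists_le_deriv (hL : IsOMinimal L) {H : ℝ → ℝ} (hH : DefCurve L H) {C : ℝ}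
    (hpos : ∀ᶠ t in 𝓝[>] (0 : ℝ), 0 < H t) (hle : ∀ᶠ t in 𝓝[>] (0 : ℝ), H t ≤ C * t) :
    ∃ c > 0, ∀ᶠ t in 𝓝[>] (0 : ℝ), ∀ H', HasDerivAt H H' t → c * (H t / t) ≤ H' := by
  have hid : DefCurve L fun t => t := DefFun.coord 0
  have hg : DefCurve L fun t => H t * t⁻¹ := hL.mul hH (hL.inv hid)
  have hid0 : Tendsto (fun t : ℝ => t) (𝓝[>] 0) (𝓝 0) := nhdsWithin_le_nhds
  have hH0 : Tendsto H (𝓝[>] 0) (𝓝 0) := by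
    refine squeeze_zero' (hpos.mono fun t ht => ht.le) hle ?_
    simpa using hid0.const_mul C
  have hpos0 : ∀ᶠ t in 𝓝[>] (0 : ℝ), 0 < t := self_mem_nhdsWithin
  obtain ⟨δ, hδ, h⟩ := hL.exists_monotoneOn_or_antitoneOn hg
  rcases h with h | h
  -- If `H / t` is nondecreasing, nonnegativity of its derivative says `H / t ≤ H'`.
  · refine ⟨1, one_pos, ?_⟩
    filter_upwards [Ioo_mem_nhdsGT hδ] with t ht H' hH'
    have hd := hH'.mul (hasDerivAt_inv ht.1.ne')
    have h2 := h.derivWithin_nonneg (x := t)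
    rw [derivWithin_of_mem_nhds (Ioo_mem_nhds ht.1 ht.2)] at h2
    have h3 : deriv (fun t => H t * t⁻¹) t = _ := hd.deriv
    rw [h3] at h2
    have ht0 := ht.1
    have h4 : H' * t⁻¹ + H t * -(t ^ 2)⁻¹ = (H' - H t / t) / t := by field_simp; ring
    rw [h4] at h2
    have := mul_nonneg h2 ht0.le
    rw [div_mul_cancel₀ _ ht0.ne'] at this
    linarith
  -- If `H / t` is nonincreasing, it stays above its value `g₀` at `t₀`. Differentiating `t ≤ H /
  -- g₀` gives `g₀ ≤ H'`, and `H / t ≤ C` turns this into the claim with constant `g₀ / C`.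
  · obtain ⟨t₀, ⟨ht₀, hH₀⟩, ht₀'⟩ := (((eventually_mem_set.2 (Ioo_mem_nhdsGT hδ)).and hpos).and
      hpos0).exists
    set g₀ := H t₀ * t₀⁻¹ with hg₀
    have hg₀pos : 0 < g₀ := mul_pos hH₀ (inv_pos.2 ht₀')
    have hCpos : 0 < C := by
      obtain ⟨t, h1, h2, h3⟩ := (hpos.and (hle.and hpos0)).exists
      by_contra hC
      nlinarith
    have hlow : ∀ᶠ t in 𝓝[>] (0 : ℝ), |t| ≤ g₀⁻¹ * H t := by
      filter_upwards [Ioo_mem_nhdsGT ht₀'] with t ht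
      have h5 := h ⟨ht.1, ht.2.trans ht₀.2⟩ ht₀ ht.2.le
      have h6 : g₀ ≤ H t * t⁻¹ := h5
      rw [abs_of_pos ht.1, inv_mul_eq_div, le_div_iff₀ hg₀pos]
      rw [← div_eq_mul_inv, le_div_iff₀ ht.1] at h6
      linarith
    refine ⟨g₀ / C, div_pos hg₀pos hCpos, ?_⟩
    filter_upwards [hL.eventually_abs_deriv_le hid hH hid0 hH0 hlow, hle, hpos0]
      with t h1 h2 h3 H' hH'
    have h4 := h1 1 H' (hasDerivAt_id t) hH'
    rw [abs_one, inv_mul_eq_div, le_div_iff₀ hg₀pos, one_mul] at h4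
    refine le_trans ?_ h4
    rw [div_mul_div_comm, div_le_iff₀ (by positivity)]
    nlinarith

end Monotonicity

/-! ### Angles, tangent spaces and retractions -/

section Geometry

variable {n : ℕ}

theorem inner_le_eta {v m : E n} {B : Submodule ℝ (E n)} (hm : m ∈ Bᗮ) (h1 : ‖m‖ = 1) :
    inner ℝ v m ≤ eta v B := by
  refine le_csSup ⟨‖v‖, ?_⟩ ⟨m, hm, h1, rfl⟩
  rintro _ ⟨m', -, h1', rfl⟩
  simpa [h1'] using real_inner_le_norm v m'

theorem eta_le_norm (v : E n) (B : Submodule ℝ (E n)) : eta v B ≤ ‖v‖ := by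
  refine Real.sSup_le ?_ (norm_nonneg v)
  rintro _ ⟨m', -, h1', rfl⟩
  simpa [h1'] using real_inner_le_norm v m'

theorem eta_nonneg (v : E n) (B : Submodule ℝ (E n)) : 0 ≤ eta v B := by
  by_cases h : ∃ m ∈ Bᗮ, ‖m‖ = 1
  · obtain ⟨m, hm, h1⟩ := h
    have h2 := inner_le_eta (v := v) hm h1
    have h3 := inner_le_eta (v := v) (neg_mem hm) (by rwa [norm_neg])
    rw [inner_neg_right] at h3
    linarith
  · have : {r : ℝ | ∃ m ∈ Bᗮ, ‖m‖ = 1 ∧ r = inner ℝ v m} = ∅ := by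
      ext r
      simp only [mem_ofPred_eq, mem_empty_iff_false, iff_false]
      rintro ⟨m, hm, h1, -⟩
      exact h ⟨m, hm, h1⟩
    rw [eta, this, Real.sSup_empty]

theorem exists_normal_of_lt_eta {v : E n} {B : Submodule ℝ (E n)} {ε : ℝ} (hε : 0 ≤ ε)
    (h : ε < eta v B) : ∃ m ∈ Bᗮ, ‖m‖ = 1 ∧ ε < inner ℝ v m := by
  by_contra hcon
  push Not at hcon
  refine absurd h (not_lt.2 (Real.sSup_le ?_ hε))
  rintro _ ⟨m, hm, h1, rfl⟩
  exact hcon m hm h1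

theorem subspaceDist_nonneg (A B : Submodule ℝ (E n)) : 0 ≤ subspaceDist A B := by
  refine Real.sSup_nonneg ?_
  rintro _ ⟨v, -, -, rfl⟩
  exact eta_nonneg v B

theorem inner_le_mul_subspaceDist {A B : Submodule ℝ (E n)} {v m : E n} (hv : v ∈ A)
    (hm : m ∈ Bᗮ) (h1 : ‖m‖ = 1) : inner ℝ v m ≤ ‖v‖ * subspaceDist A B := by
  rcases eq_or_ne v 0 with rfl | hv0
  · simp
  have hpos : 0 < ‖v‖ := norm_pos_iff.2 hv0
  have hunit : ‖‖v‖⁻¹ • v‖ = 1 := by rw [norm_smul, norm_inv, norm_norm, inv_mul_cancel₀ hpos.ne']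
  have h2 : eta (‖v‖⁻¹ • v) B ≤ subspaceDist A B := by
    refine le_csSup ⟨1, ?_⟩ ⟨_, A.smul_mem _ hv, hunit, rfl⟩
    rintro _ ⟨w, -, hw, rfl⟩
    exact hw ▸ eta_le_norm w B
  have h3 := (inner_le_eta (v := ‖v‖⁻¹ • v) hm h1).trans h2
  rw [real_inner_smul_left, inv_mul_le_iff₀ hpos] at h3
  exact h3

theorem abs_inner_le_mul_subspaceDist {A B : Submodule ℝ (E n)} {v m : E n} (hv : v ∈ A)
    (hm : m ∈ Bᗮ) (h1 : ‖m‖ = 1) : |inner ℝ v m| ≤ ‖v‖ * subspaceDist A B := by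
  refine abs_le'.2 ⟨inner_le_mul_subspaceDist hv hm h1, ?_⟩
  have := inner_le_mul_subspaceDist (neg_mem hv) hm h1
  rwa [inner_neg_left, norm_neg] at this

/-- A first-order description, from which definability of the tangent cone can be read off. -/
theorem mem_tangentConeAt_iff_forall {Y : Set (E n)} {y v : E n} :
    v ∈ tangentConeAt ℝ Y y ↔ ∀ δ : ℝ, 0 < δ → ∀ ε : ℝ, 0 < ε → ∃ c : ℝ, ∃ d : E n,
      ‖d‖ < δ ∧ y + d ∈ Y ∧ ‖v - c • d‖ < ε := by
  rw [Metric.nhds_basis_ball.tangentConeAt_eq_biInter_closure]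
  simp only [mem_iInter, Metric.mem_closure_iff, Set.mem_smul, dist_eq_norm]
  refine forall₂_congr fun δ _ => forall₂_congr fun ε _ => ⟨?_, ?_⟩
  · rintro ⟨_, ⟨c, -, d, hd, rfl⟩, h⟩
    exact ⟨c, d, by simpa using hd.1, hd.2, h⟩
  · rintro ⟨c, d, h1, h2, h3⟩
    exact ⟨_, ⟨c, mem_univ _, d, ⟨by simpa using h1, h2⟩, rfl⟩, h3⟩

/-- Normality is tested on the cone alone, which keeps linear spans out of the defining formulas. -/
theorem mem_tangent_orthogonal_iff {Y : Set (E n)} {y m : E n} :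
    m ∈ (tangent Y y)ᗮ ↔ ∀ v, v ∈ tangentConeAt ℝ Y y → inner ℝ v m = 0 := by
  rw [tangent, Submodule.mem_orthogonal]
  refine ⟨fun h v hv => h v (Submodule.subset_span hv), fun h v hv => ?_⟩
  induction hv using Submodule.span_induction with
  | mem v hv => exact h v hv
  | zero => exact inner_zero_left _
  | add v w _ _ h1 h2 => rw [inner_add_left, h1, h2, add_zero]
  | smul c v _ h => rw [real_inner_smul_left, h, mul_zero]

theorem mem_tangentConeAt_of_hasDerivAt {X : Set (E n)} {f : ℝ → E n} {f' : E n} {t : ℝ}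
    (hf : HasDerivAt f f' t) (hX : ∀ᶠ s in 𝓝 t, f s ∈ X) : f' ∈ tangentConeAt ℝ X (f t) := by
  have h := (hf.hasFDerivAt.hasFDerivWithinAt (s := f ⁻¹' X)).mapsTo_tangent_cone
  rw [tangentConeAt_of_mem_nhds (show f ⁻¹' X ∈ 𝓝 t from hX)] at h
  have h1 := h (mem_univ (1 : ℝ))
  simp only [ContinuousLinearMap.toSpanSingleton_apply, one_smul] at h1
  exact tangentConeAt_mono (image_preimage_subset f X) h1

theorem tangentConeAt_submodule_subset (V : Submodule ℝ (E n)) {z : E n} (hz : z ∈ V) :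
    tangentConeAt ℝ (V : Set (E n)) z ⊆ V := by
  intro v hv
  obtain ⟨α, l, hl, c, d, -, hmem, hlim⟩ := exists_fun_of_mem_tangentConeAt hv
  refine V.closed_of_finiteDimensional.mem_of_tendsto hlim (hmem.mono fun a ha => ?_)
  exact V.smul_mem _ ((V.add_mem_iff_right hz).1 ha)

/-- The tangent spaces of a `C²` submanifold depend on the base point in a locally Lipschitz way. -/
theorem IsC2Submanifold.exists_tangent_lipschitz {d : ℕ} {X : Set (E n)} (hX : IsC2Submanifold d X)
    {p : E n} (hp : p ∈ X) : ∃ K : ℝ, 0 ≤ K ∧ ∃ U ∈ 𝓝 p, ∀ x ∈ X ∩ U, ∀ x' ∈ X ∩ U,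
      ∀ v ∈ tangent X x, ∃ v' ∈ tangent X x', ‖v - v'‖ ≤ K * ‖x - x'‖ * ‖v‖ := by
  obtain ⟨φ, V, hps, hφ, hψ, -, hXV⟩ := hX p hp
  have hsrc : ∀ x ∈ φ.source, φ.source ∈ 𝓝 x := fun x hx => φ.open_source.mem_nhds hx
  have htgt : ∀ z ∈ φ.target, φ.target ∈ 𝓝 z := fun z hz => φ.open_target.mem_nhds hz
  have hφd : ∀ x ∈ φ.source, HasFDerivAt φ (fderiv ℝ φ x) x := fun x hx =>
    (((hφ x hx).contDiffAt (hsrc x hx)).differentiableAt (by norm_num)).hasFDerivAt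
  have hψd : ∀ z ∈ φ.target, HasFDerivAt φ.symm (fderiv ℝ φ.symm z) z := fun z hz =>
    (((hψ z hz).contDiffAt (htgt z hz)).differentiableAt (by norm_num)).hasFDerivAt
  have hinv : ∀ x ∈ φ.source, ∀ v, fderiv ℝ φ.symm (φ x) (fderiv ℝ φ x v) = v := by
    intro x hx v
    have h1 := (hψd _ (φ.map_source hx)).comp x (hφd x hx)
    have h2 : HasFDerivAt (φ.symm ∘ φ) (ContinuousLinearMap.id ℝ (E n)) x :=
      (hasFDerivAt_id x).congr_of_eventuallyEq (by
        filter_upwards [hsrc x hx] with y hy using φ.left_inv hy)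
    have := congrArg (fun T : E n →L[ℝ] E n => T v) (h1.unique h2)
    simpa using this
  -- Together with `hup`, this identifies each tangent space with the model `V` through the
  -- derivatives of the chart and its inverse.
  have hdown : ∀ x ∈ φ.source, x ∈ X → ∀ v ∈ tangent X x, fderiv ℝ φ x v ∈ V := by
    intro x hx hxX v hv
    have : tangent X x ≤ V.comap (fderiv ℝ φ x : E n →ₗ[ℝ] E n) := by
      refine Submodule.span_le.2 fun w hw => ?_
      rw [← tangentConeAt_inter_nhds (hsrc x hx)] at hw
      have h1 := ((hφd x hx).hasFDerivWithinAt (s := X ∩ φ.source)).mapsTo_tangent_cone hw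
      refine tangentConeAt_submodule_subset V ((hXV x hx).1 hxX) (tangentConeAt_mono ?_ h1)
      rintro _ ⟨y, hy, rfl⟩
      exact (hXV y hy.2).1 hy.1
    exact this hv
  have hup : ∀ x ∈ φ.source, x ∈ X → ∀ w ∈ V, fderiv ℝ φ.symm (φ x) w ∈ tangent X x := by
    intro x hx hxX w hw
    have hline : HasDerivAt (fun s : ℝ => φ x + s • w) w 0 := by
      simpa using ((hasDerivAt_id (0 : ℝ)).smul_const w).const_add (φ x)
    have hz : φ x + (0 : ℝ) • w = φ x := by simp
    have hcurve : HasDerivAt (fun s : ℝ => φ.symm (φ x + s • w))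
        (fderiv ℝ φ.symm (φ x) w) 0 := by
      have h1 : HasFDerivAt φ.symm (fderiv ℝ φ.symm (φ x)) (φ x + (0 : ℝ) • w) := by
        rw [hz]; exact hψd _ (φ.map_source hx)
      exact h1.comp_hasDerivAt (0 : ℝ) hline
    have hev : ∀ᶠ s : ℝ in 𝓝 0, φ.symm (φ x + s • w) ∈ X := by
      have hc : Tendsto (fun s : ℝ => φ x + s • w) (𝓝 0) (𝓝 (φ x)) := by
        have := hline.continuousAt.tendsto
        rwa [hz] at this
      filter_upwards [hc.eventually (htgt _ (φ.map_source hx))] with s hs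
      rw [hXV _ (φ.map_target hs), φ.right_inv hs]
      exact V.add_mem ((hXV x hx).1 hxX) (V.smul_mem _ hw)
    have := mem_tangentConeAt_of_hasDerivAt hcurve hev
    rw [hz, φ.left_inv hx] at this
    exact Submodule.subset_span this
  have hφp : ContDiffAt ℝ 2 φ p := (hφ p hps).contDiffAt (hsrc p hps)
  have hψp : ContDiffAt ℝ 2 φ.symm (φ p) :=
    (hψ _ (φ.map_source hps)).contDiffAt (htgt _ (φ.map_source hps))
  -- Here class `C²` is essential: the derivative of the inverse chart is `C¹`, hence locally
  -- Lipschitz.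
  have hB : ContDiffAt ℝ 1 (fun x => fderiv ℝ φ.symm (φ x)) p :=
    (hψp.fderiv_right (m := 1) (by norm_num)).comp p (hφp.of_le (by norm_num))
  obtain ⟨K, U, hU, hK⟩ := hB.exists_lipschitzOnWith
  have hA : ContinuousAt (fderiv ℝ φ) p :=
    (hφp.fderiv_right (m := 1) (by norm_num)).continuousAt
  have hAb : ∀ᶠ x in 𝓝 p, ‖fderiv ℝ φ x‖ < ‖fderiv ℝ φ p‖ + 1 :=
    hA.norm.eventually_lt continuousAt_const (by linarith)
  refine ⟨K * (‖fderiv ℝ φ p‖ + 1), by positivity, _,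
    inter_mem (inter_mem hU (hsrc p hps)) hAb, ?_⟩
  rintro x ⟨hxX, ⟨hxU, hxs⟩, hxA⟩ x' ⟨hxX', ⟨hxU', hxs'⟩, -⟩ v hv
  -- The vector is sent to `V` by the chart at `x` and brought back at `x'`.
  refine ⟨_, hup x' hxs' hxX' _ (hdown x hxs hxX v hv), ?_⟩
  calc ‖v - fderiv ℝ φ.symm (φ x') (fderiv ℝ φ x v)‖
      = ‖(fderiv ℝ φ.symm (φ x) - fderiv ℝ φ.symm (φ x')) (fderiv ℝ φ x v)‖ := by
        rw [_root_.sub_apply, hinv x hxs]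
    _ ≤ ‖fderiv ℝ φ.symm (φ x) - fderiv ℝ φ.symm (φ x')‖ * (‖fderiv ℝ φ x‖ * ‖v‖) :=
        (ContinuousLinearMap.le_opNorm _ _).trans
          (mul_le_mul_of_nonneg_left (ContinuousLinearMap.le_opNorm _ _) (norm_nonneg _))
    _ ≤ (K * ‖x - x'‖) * ((‖fderiv ℝ φ p‖ + 1) * ‖v‖) := by
        gcongr
        · have := hK.dist_le_mul x hxU x' hxU'
          rwa [dist_eq_norm, dist_eq_norm] at this
        · exact le_of_lt hxA
    _ = _ := by ring

/-- A local retraction onto `X` moves a point by at most a multiple of its distance to the points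
of `X`. -/
theorem IsLocalRetraction.exists_norm_le {X : Set (E n)} {p : E n} {π : E n → E n}
    (h : IsLocalRetraction X p π) : ∃ C : ℝ, 1 ≤ C ∧ ∃ r > 0, ∀ y, ‖y - p‖ < r → π y ∈ X ∧
      ∀ x ∈ X, ‖x - p‖ < r → ‖π y - y‖ ≤ C * ‖x - y‖ := by
  rcases h with h | ⟨hC, h⟩
  · obtain ⟨r, hr, hball⟩ := Metric.eventually_nhds_iff.1 h
    refine ⟨1, le_rfl, r, hr, fun y hy => ?_⟩
    obtain ⟨h1, h2⟩ := hball (by rwa [dist_eq_norm] : dist y p < r)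
    refine ⟨h1, fun x hx _ => ?_⟩
    rw [one_mul, norm_sub_rev, ← dist_eq_norm, h2, norm_sub_rev x y, ← dist_eq_norm]
    exact Metric.infDist_le_dist_of_mem hx
  · obtain ⟨K, U, hU, hK⟩ := hC.exists_lipschitzOnWith
    obtain ⟨r, hr, hball⟩ := Metric.eventually_nhds_iff.1 (h.and hU)
    -- Since `π x = x`, one has `π y - y = (π y - π x) + (x - y)`, with `π` being `K`-Lipschitz.
    refine ⟨K + 1, by simp, r, hr, fun y hy => ?_⟩
    obtain ⟨⟨h1, -⟩, hyU⟩ := hball (by rwa [dist_eq_norm] : dist y p < r)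
    refine ⟨h1, fun x hx hxr => ?_⟩
    obtain ⟨⟨-, h2⟩, hxU⟩ := hball (by rwa [dist_eq_norm] : dist x p < r)
    have h3 := hK.dist_le_mul y hyU x hxU
    rw [dist_eq_norm, dist_eq_norm, h2 hx, norm_sub_rev y x] at h3
    calc ‖π y - y‖ = ‖(π y - x) + (x - y)‖ := by congr 1; abel
      _ ≤ ‖π y - x‖ + ‖x - y‖ := norm_add_le _ _
      _ ≤ (K + 1) * ‖x - y‖ := by linarith

end Geometry

/-! ### Curve selection -/

section CurveSelection

variable {L : FirstOrder.Language.{u, v}} [L.Structure ℝ] {α : Type} {n : ℕ}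

theorem defPred_mem_tangent_orthogonal (hL : IsOMinimal L) {Y : Set (E n)} (hY : IsDefinable L Y)
    {f g : (α → ℝ) → E n} [Finite α] (hf : DefVec L f) (hg : DefVec L g) :
    DefPred L fun w => g w ∈ (tangent Y (f w))ᗮ := by
  refine DefPred.congr (P := fun w => ∀ v : E n,
    (∀ δ : ℝ, 0 < δ → ∀ ε : ℝ, 0 < ε → ∃ c : ℝ, ∃ d : E n,
      ‖d‖ < δ ∧ f w + d ∈ Y ∧ ‖v - c • d‖ < ε) → inner ℝ v (g w) = 0) ?_ fun w => ?_
  · refine .forall_vec (.imp (.forall_real (.imp (hL.lt (.const 0) (.coord _)) (.forall_real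
      (.imp (hL.lt (.const 0) (.coord _)) (.exists_real (.exists_vec (.and
        (hL.lt (hL.defFun_norm (.tuple _)) (.coord _)) (.and (hY.mem (hL.vec_add
          (hf.comp fun a => .coord _) (.tuple _))) (hL.lt (hL.defFun_norm (hL.vec_sub (.tuple _)
            (hL.vec_smul (.coord _) (.tuple _)))) (.coord _)))))))))) ?_)
    exact (hL.defFun_inner (.tuple _) (hg.comp fun a => .coord _)).eq (.const 0)
  · rw [mem_tangent_orthogonal_iff]
    simp only [mem_tangentConeAt_iff_forall]

/-- A curve in `ℝⁿ` with definable coordinates. -/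
def DefVecCurve (L : FirstOrder.Language.{u, v}) [L.Structure ℝ] (f : ℝ → E n) : Prop :=
  ∀ i, DefCurve L fun t => f t i

/-- Curve selection at `p` in a bounded definable set of triples of vectors, parametrized by the
distance of the first vector to `p`. -/
theorem IsOMinimal.exists_curve (hL : IsOMinimal L) {P : E n → E n → E n → Prop}
    (hP : DefPred L fun w : Fin n ⊕ Fin n ⊕ Fin n → ℝ => P (WithLp.toLp 2 fun i => w (.inl i))
      (WithLp.toLp 2 fun i => w (.inr (.inl i))) (WithLp.toLp 2 fun i => w (.inr (.inr i))))
    {p : E n} {M : ℝ} (hM : ∀ y x m, P y x m → ‖y‖ ≤ M ∧ ‖x‖ ≤ M ∧ ‖m‖ ≤ M)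
    (hp : ∃ᶠ y in 𝓝[≠] p, ∃ x m, P y x m) :
    ∃ y x m : ℝ → E n, DefVecCurve L y ∧ DefVecCurve L x ∧ DefVecCurve L m ∧
      ∀ᶠ t in 𝓝[>] (0 : ℝ), ‖y t - p‖ = t ∧ P (y t) (x t) (m t) := by
  have hP' : ∀ {γ : Type} {f g h : (γ → ℝ) → E n}, DefVec L f → DefVec L g → DefVec L h →
      DefPred L fun v => P (f v) (g v) (h v) := by
    intro γ f g h hf hg hh
    refine hP.comp (F := fun v => Sum.elim (fun i => f v i)
      (Sum.elim (fun i => g v i) (fun i => h v i))) ?_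
    rintro (i | i | i)
    exacts [hf i, hg i, hh i]
  have hT : DefPred L fun w : Fin 1 → ℝ => ∃ y : E n, ‖y - p‖ = w 0 ∧ ∃ x m : E n, P y x m :=
    .exists_vec (.and ((hL.defFun_norm (hL.vec_sub (.tuple _) (.const p))).eq (.coord _))
      (.exists_vec (.exists_vec (hP' (.tuple _) (.tuple _) (.tuple _)))))
  have hev : ∀ᶠ t in 𝓝[>] (0 : ℝ), ∃ y : E n, ‖y - p‖ = t ∧ ∃ x m : E n, P y x m := by
    -- The attained distances form a definable set accumulating at `0`, hence containing some `(0,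
    -- δ)`.
    refine (hL.eventually_gt_or (P := fun t => ∃ y : E n, ‖y - p‖ = t ∧ ∃ x m : E n, P y x m)
      hT 0).resolve_right fun h => ?_
    refine hp ?_
    have htend : Tendsto (fun y => ‖y - p‖) (𝓝[≠] p) (𝓝[>] 0) := tendsto_norm_sub_self_nhdsNE p
    filter_upwards [htend.eventually h] with y hy hex
    exact hy ⟨y, rfl, hex⟩
  obtain ⟨δ, hδ, hsub⟩ := (mem_nhdsGT_iff_exists_Ioo_subset).1 hev
  -- Choice needs every fibre nonempty, so the zero triple is prescribed outside `(0, δ)`.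
  have hchoice := hL.exists_choice (α := Fin 1) (Fin n ⊕ Fin n ⊕ Fin n) (M := max M 0)
    (fun v w => ((0 < v 0 ∧ v 0 < δ) ∧ ‖WithLp.toLp 2 (fun i => w (.inl i)) - p‖ = v 0 ∧
        P (WithLp.toLp 2 fun i => w (.inl i)) (WithLp.toLp 2 fun i => w (.inr (.inl i)))
          (WithLp.toLp 2 fun i => w (.inr (.inr i)))) ∨
      (¬ (0 < v 0 ∧ v 0 < δ) ∧ ‖(WithLp.toLp 2 (fun i => w (.inl i)) : E n)‖ = 0 ∧
        ‖(WithLp.toLp 2 (fun i => w (.inr (.inl i))) : E n)‖ = 0 ∧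
        ‖(WithLp.toLp 2 (fun i => w (.inr (.inr i))) : E n)‖ = 0))
  obtain ⟨g, hg, hgS⟩ := hchoice (by
    have hI : DefPred L fun w : Fin 1 ⊕ (Fin n ⊕ Fin n ⊕ Fin n) → ℝ =>
        0 < w (.inl 0) ∧ w (.inl 0) < δ :=
      (hL.lt (.const 0) (.coord _)).and (hL.lt (.coord _) (.const δ))
    refine .or (.and hI (.and ((hL.defFun_norm (hL.vec_sub (.tuple _) (.const p))).eq (.coord _))
      (hP' (.tuple _) (.tuple _) (.tuple _)))) (.and hI.not (.and
        ((hL.defFun_norm (.tuple _)).eq (.const 0)) (.and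
          ((hL.defFun_norm (.tuple _)).eq (.const 0)) ?_)))
    exact (hL.defFun_norm (.tuple _)).eq (.const 0))
   (by
    intro v
    by_cases hv : 0 < v 0 ∧ v 0 < δ
    · obtain ⟨y, hy, x, m, hyxm⟩ := hsub hv
      exact ⟨Sum.elim y (Sum.elim x m), .inl ⟨hv, hy, hyxm⟩⟩
    · exact ⟨fun _ => 0, .inr ⟨hv, norm_zero, norm_zero, norm_zero⟩⟩)
   (by
    have key : ∀ (u : E n), (‖u‖ ≤ M ∨ ‖u‖ = 0) → ∀ i, |u i| ≤ max M 0 := fun u hu i => by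
      refine (PiLp.norm_apply_le u i).trans ?_
      rcases hu with hu | hu
      exacts [hu.trans (le_max_left _ _), hu.le.trans (le_max_right _ _)]
    rintro v w (⟨-, -, h⟩ | ⟨-, h1, h2, h3⟩) (i | i | i)
    · exact key _ (.inl (hM _ _ _ h).1) i
    · exact key _ (.inl (hM _ _ _ h).2.1) i
    · exact key _ (.inl (hM _ _ _ h).2.2) i
    · exact key _ (.inr h1) i
    · exact key _ (.inr h2) i
    · exact key _ (.inr h3) i)
  refine ⟨fun t => WithLp.toLp 2 fun i => g (fun _ => t) (.inl i),
    fun t => WithLp.toLp 2 fun i => g (fun _ => t) (.inr (.inl i)),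
    fun t => WithLp.toLp 2 fun i => g (fun _ => t) (.inr (.inr i)),
    fun i => (hg (.inl i)).comp (F := fun w _ => w 0) fun _ => .coord 0,
    fun i => (hg (.inr (.inl i))).comp (F := fun w _ => w 0) fun _ => .coord 0,
    fun i => (hg (.inr (.inr i))).comp (F := fun w _ => w 0) fun _ => .coord 0, ?_⟩
  filter_upwards [Ioo_mem_nhdsGT hδ] with t ht
  exact ((hgS fun _ => t).resolve_right fun h => h.1 ht).2

theorem IsOMinimal.exists_tendsto_vec (hL : IsOMinimal L) {f : ℝ → E n} (hf : DefVecCurve L f)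
    {M : ℝ} (hM : ∀ᶠ t in 𝓝[>] (0 : ℝ), ‖f t‖ ≤ M) : ∃ c, Tendsto f (𝓝[>] 0) (𝓝 c) := by
  have h : ∀ i, ∃ c, Tendsto (fun t => f t i) (𝓝[>] 0) (𝓝 c) := fun i =>
    hL.exists_tendsto (hf i) (hM.mono fun t ht => (PiLp.norm_apply_le (f t) i).trans ht)
  choose c hc using h
  refine ⟨WithLp.toLp 2 c, ?_⟩
  exact ((PiLp.continuous_toLp 2 (fun _ : Fin n => ℝ)).tendsto c).comp (tendsto_pi_nhds.2 hc)

theorem norm_le_card_mul {u : E n} {B : ℝ} (h : ∀ i, |u i| ≤ B) : ‖u‖ ≤ n * B := by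
  have h1 : u = ∑ i, EuclideanSpace.single i (u i) := by
    ext j
    simp [Finset.sum_apply]
  calc ‖u‖ = ‖∑ i, EuclideanSpace.single i (u i)‖ := by rw [← h1]
    _ ≤ ∑ i, ‖EuclideanSpace.single i (u i)‖ := norm_sum_le _ _
    _ = ∑ i, |u i| := by simp
    _ ≤ ∑ _i : Fin n, B := Finset.sum_le_sum fun i _ => h i
    _ = n * B := by simp

/-- A bound of a definable curve by a definable function, both tending to `0`, is inherited by the
derivatives, up to the factor `n`. -/
theorem IsOMinimal.eventually_norm_deriv_le (hL : IsOMinimal L) {f : ℝ → E n} {G : ℝ → ℝ}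
    (hf : DefVecCurve L f) (hG : DefCurve L G) (hf0 : Tendsto f (𝓝[>] 0) (𝓝 0))
    (hG0 : Tendsto G (𝓝[>] 0) (𝓝 0)) {C : ℝ} (hle : ∀ᶠ t in 𝓝[>] (0 : ℝ), ‖f t‖ ≤ C * G t) :
    ∀ᶠ t in 𝓝[>] (0 : ℝ), ∀ f' G', HasDerivAt f f' t → HasDerivAt G G' t →
      ‖f'‖ ≤ n * (C * G') := by
  have h : ∀ i, ∀ᶠ t in 𝓝[>] (0 : ℝ), ∀ F' G', HasDerivAt (fun s => f s i) F' t →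
      HasDerivAt G G' t → |F'| ≤ C * G' := fun i =>
    hL.eventually_abs_deriv_le (hf i) hG
      (by simpa [Function.comp_def] using
        ((EuclideanSpace.proj (𝕜 := ℝ) i).continuous.tendsto 0).comp hf0) hG0
      (hle.mono fun t ht => (PiLp.norm_apply_le (f t) i).trans ht)
  filter_upwards [eventually_all.2 h] with t ht f' G' hf' hG'
  refine norm_le_card_mul fun i => ht i _ _ ?_ hG'
  exact (EuclideanSpace.proj (𝕜 := ℝ) i).hasFDerivAt.comp_hasDerivAt t hf'

end CurveSelection

/-! ### The ratio test implies Whitney's condition (b) -/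

section Main

variable {L : FirstOrder.Language.{u, v}} [L.Structure ℝ] {n : ℕ}

/-- Along a definable curve on which the secant direction `x - y` stays away from the tangent space
of `Y`, the angle between the tangent spaces of `X` and `Y` is not small compared with
`‖x - y‖ / ‖y - p‖`. -/
theorem IsOMinimal.exists_frequently_tangent (hL : IsOMinimal L) {X Y : Set (E n)} {p : E n}
    {y x m : ℝ → E n} (hy : DefVecCurve L y) (hx : DefVecCurve L x) (hm : DefVecCurve L m)
    {C ε : ℝ} (hε : 0 < ε)
    (hyp : ∀ᶠ t in 𝓝[>] (0 : ℝ), ‖y t - p‖ = t) (hyY : ∀ᶠ t in 𝓝[>] (0 : ℝ), y t ∈ Y)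
    (hxX : ∀ᶠ t in 𝓝[>] (0 : ℝ), x t ∈ X) (hm1 : ∀ᶠ t in 𝓝[>] (0 : ℝ), ‖m t‖ = 1)
    (hmY : ∀ᶠ t in 𝓝[>] (0 : ℝ), m t ∈ (tangent Y (y t))ᗮ)
    (hang : ∀ᶠ t in 𝓝[>] (0 : ℝ), ε * ‖x t - y t‖ ≤ inner ℝ (x t - y t) (m t))
    (hC : ∀ᶠ t in 𝓝[>] (0 : ℝ), ‖x t - y t‖ ≤ C * t)
    (hne : ∀ᶠ t in 𝓝[>] (0 : ℝ), 0 < ‖x t - y t‖) :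
    ∃ c > 0, ∃ D : ℝ, ∃ᶠ t in 𝓝[>] (0 : ℝ), ∃ w ∈ tangent X (x t),
      ‖w‖ ≤ D ∧ c * ‖x t - y t‖ ≤ t * |inner ℝ w (m t)| := by
  have hpos : ∀ᶠ t in 𝓝[>] (0 : ℝ), 0 < t := self_mem_nhdsWithin
  have hid : DefCurve L fun t => t := DefFun.coord 0
  have hid0 : Tendsto (fun t : ℝ => t) (𝓝[>] 0) (𝓝 0) := nhdsWithin_le_nhds
  set q : ℝ → E n := fun t => x t - y t
  have hq : DefVecCurve L q := fun i => hL.sub (hx i) (hy i)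
  have hq0 : Tendsto q (𝓝[>] 0) (𝓝 0) :=
    squeeze_zero_norm' hC (by simpa using hid0.const_mul C)
  -- Pairing with the constant `m₀` instead of `m` gives a germ whose derivative involves only `q'`.
  obtain ⟨m₀, hm₀⟩ := hL.exists_tendsto_vec hm (hm1.mono fun t ht => ht.le)
  have hmm : ∀ η > 0, ∀ᶠ t in 𝓝[>] (0 : ℝ), ‖m t - m₀‖ < η := fun η hη => by
    simpa [dist_eq_norm] using Metric.tendsto_nhds.1 hm₀ η hη
  set H : ℝ → ℝ := fun t => inner ℝ (q t) m₀
  have hH : DefCurve L H := hL.defFun_inner (f := fun w : Fin 1 → ℝ => q (w 0)) (g := fun _ => m₀)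
    hq (.const m₀)
  have hHlow : ∀ᶠ t in 𝓝[>] (0 : ℝ), ε / 2 * ‖q t‖ ≤ H t := by
    filter_upwards [hang, hmm (ε / 2) (by positivity)] with t h1 h2
    have h3 : H t = inner ℝ (q t) (m t) - inner ℝ (q t) (m t - m₀) := by
      rw [inner_sub_right]; ring
    have h4 := real_inner_le_norm (q t) (m t - m₀)
    have h5 : ‖q t‖ * ‖m t - m₀‖ ≤ ‖q t‖ * (ε / 2) :=
      mul_le_mul_of_nonneg_left h2.le (norm_nonneg _)
    have h6 : ε * ‖q t‖ ≤ inner ℝ (q t) (m t) := h1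
    rw [h3]
    linarith
  have hHpos : ∀ᶠ t in 𝓝[>] (0 : ℝ), 0 < H t := by
    filter_upwards [hHlow, hne] with t h1 h2
    exact (mul_pos (half_pos hε) h2).trans_le h1
  have hHle : ∀ᶠ t in 𝓝[>] (0 : ℝ), H t ≤ C * ‖m₀‖ * t := by
    filter_upwards [hC] with t h1
    have h2 := real_inner_le_norm (q t) m₀
    have h3 : ‖q t‖ * ‖m₀‖ ≤ C * t * ‖m₀‖ := mul_le_mul_of_nonneg_right h1 (norm_nonneg _)
    linarith
  have hH0 : Tendsto H (𝓝[>] 0) (𝓝 0) := by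
    simpa using hq0.inner (tendsto_const_nhds (x := m₀))
  obtain ⟨c, hc, hcH⟩ := hL.exists_le_deriv hH hHpos hHle
  have hq' := hL.eventually_norm_deriv_le hq hH hq0 hH0 (C := 2 / ε) (hHlow.mono fun t ht => by
    rw [div_mul_eq_mul_div, le_div_iff₀ hε]; linarith)
  have hxp : ∀ᶠ t in 𝓝[>] (0 : ℝ), ‖x t - p‖ ≤ (C + 1) * t := by
    filter_upwards [hC, hyp] with t h1 h2
    calc ‖x t - p‖ = ‖(x t - y t) + (y t - p)‖ := by congr 1; abel
      _ ≤ ‖x t - y t‖ + ‖y t - p‖ := norm_add_le _ _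
      _ ≤ (C + 1) * t := by linarith
  have hx' := hL.eventually_norm_deriv_le (f := fun t => x t - p) (G := fun t => t)
    (fun i => hL.sub (hx i) (.const (p i))) hid
    (squeeze_zero_norm' hxp (by simpa using hid0.const_mul (C + 1))) hid0 hxp
  have hnear : ∀ᶠ t in 𝓝[>] (0 : ℝ), ∀ᶠ s in 𝓝 t, y s ∈ Y ∧ x s ∈ X := by
    filter_upwards [eventually_eventually_nhdsWithin.2 (hyY.and hxX), hpos] with t h1 h2
    rwa [isOpen_Ioi.nhdsWithin_eq (mem_Ioi.2 h2)] at h1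
  have hfreq := hL.frequently_differentiableAt (ι := Fin n ⊕ Fin n)
    (F := Sum.elim (fun i t => y t i) (fun i t => x t i)) (by
      rintro (i | i)
      exacts [hy i, hx i])
  refine ⟨c * (ε / 4), by positivity, n * ((C + 1) * 1), ?_⟩
  -- With `‖q'‖ ≤ n (2 / ε) H'`, this threshold bounds the error `⟨q', m - m₀⟩` by `H' / 2`; the `+
  -- 1` keeps the denominator positive when `n = 0`.
  have hsmall := hmm (1 / (2 * (n * (2 / ε) + 1))) (by positivity)
  refine (hfreq.and_eventually ((hcH.and (hq'.and (hx'.and hnear))).and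
    ((hHlow.and hHpos).and ((hmY.and hm1).and (hpos.and hsmall))))).mono ?_
  rintro t ⟨hdiff, ⟨hcH, hq', hx', hnear⟩, ⟨hHlow, hHpos⟩, ⟨hmY, hm1⟩, hpos, hsmall⟩
  have hyd : DifferentiableAt ℝ y t := (differentiableAt_euclidean).2 fun i => hdiff (.inl i)
  have hxd : DifferentiableAt ℝ x t := (differentiableAt_euclidean).2 fun i => hdiff (.inr i)
  have hyt : deriv y t ∈ tangentConeAt ℝ Y (y t) :=
    mem_tangentConeAt_of_hasDerivAt hyd.hasDerivAt (hnear.mono fun s hs => hs.1)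
  have hxt : deriv x t ∈ tangentConeAt ℝ X (x t) :=
    mem_tangentConeAt_of_hasDerivAt hxd.hasDerivAt (hnear.mono fun s hs => hs.2)
  have hqd : HasDerivAt q (deriv x t - deriv y t) t := hxd.hasDerivAt.sub hyd.hasDerivAt
  set q' := deriv x t - deriv y t with hq'_def
  have hHd : HasDerivAt H (inner ℝ q' m₀) t := by
    simpa using hqd.inner ℝ (hasDerivAt_const t m₀)
  have h1 := hcH _ hHd
  have h2 := hq' _ _ hqd hHd
  refine ⟨deriv x t, Submodule.subset_span hxt,
    hx' _ _ (hxd.hasDerivAt.sub_const p) (hasDerivAt_id t), ?_⟩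
  -- The contribution of `y'` disappears because `m` is normal to `Y`.
  have h3 : inner ℝ q' (m t) = inner ℝ (deriv x t) (m t) := by
    rw [hq'_def, inner_sub_left, mem_tangent_orthogonal_iff.1 hmY _ hyt, sub_zero]
  have hH'0 : 0 ≤ inner ℝ q' m₀ := le_trans (by positivity) h1
  have h4 : inner ℝ q' m₀ ≤ 2 * |inner ℝ (deriv x t) (m t)| := by
    have h5 : inner ℝ q' m₀ = inner ℝ (deriv x t) (m t) - inner ℝ q' (m t - m₀) := by
      rw [inner_sub_right, h3]; ring
    have h6 := abs_real_inner_le_norm q' (m t - m₀)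
    have h7 : ‖q'‖ * ‖m t - m₀‖ ≤
        ((n * (2 / ε) + 1) * inner ℝ q' m₀) * (1 / (2 * (n * (2 / ε) + 1))) :=
      mul_le_mul (by nlinarith) hsmall.le (norm_nonneg _) (by positivity)
    have h8 : ((n * (2 / ε) + 1) * inner ℝ q' m₀) * (1 / (2 * (n * (2 / ε) + 1)))
        = inner ℝ q' m₀ / 2 := by
      have : (n * (2 / ε) + 1 : ℝ) ≠ 0 := by positivity
      field_simp
    have h9 := le_abs_self (inner ℝ (deriv x t) (m t))
    have h10 := neg_abs_le (inner ℝ q' (m t - m₀))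
    linarith
  have h5 : c * (ε / 2 * ‖q t‖) ≤ t * (2 * |inner ℝ (deriv x t) (m t)|) := by
    have h6 : c * (H t / t) * t ≤ 2 * |inner ℝ (deriv x t) (m t)| * t :=
      mul_le_mul_of_nonneg_right (h1.trans h4) hpos.le
    have h7 : c * (H t / t) * t = c * H t := by field_simp
    have h8 := mul_le_mul_of_nonneg_left hHlow hc.le
    linarith
  have h6 : c * (ε / 4) * ‖q t‖ ≤ t * |inner ℝ (deriv x t) (m t)| := by linarith
  exact h6

/-! ### From the ratio test to both halves of (b), for arbitrary local retractions. -/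

variable {X Y : Set (E n)} {p : E n} {π : E n → E n}

theorem alpha_nonneg (y : E n) : 0 ≤ alpha Y X π y := subspaceDist_nonneg _ _

theorem beta_nonneg (y : E n) : 0 ≤ beta Y π y := eta_nonneg _ _

theorem kuoRatio_nonneg (y : E n) : 0 ≤ kuoRatio Y X p π y :=
  div_nonneg (mul_nonneg (norm_nonneg _) (alpha_nonneg y)) (norm_nonneg _)

theorem alpha_eq_kuoRatio_mul {y : E n} (hyp : y ≠ p) (hπ : π y ≠ y) :
    alpha Y X π y = kuoRatio Y X p π y * (‖π y - y‖ / ‖y - p‖) := by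
  have h1 : ‖y - p‖ ≠ 0 := norm_ne_zero_iff.2 (sub_ne_zero.2 hyp)
  have h2 : ‖π y - y‖ ≠ 0 := norm_ne_zero_iff.2 (sub_ne_zero.2 hπ)
  rw [kuoRatio]
  field_simp

theorem ConditionR.tendsto_alpha (hXY : Disjoint X Y) (hp : p ∈ X) (hπ : IsLocalRetraction X p π)
    (hr : ConditionR Y X p π) : Tendsto (alpha Y X π) (𝓝[Y] p) (𝓝 0) := by
  obtain ⟨C, hC1, r, hr0, hC⟩ := hπ.exists_norm_le
  refine squeeze_zero' (g := fun y => C * kuoRatio Y X p π y) (.of_forall alpha_nonneg) ?_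
    (by simpa using Tendsto.const_mul C hr)
  filter_upwards [self_mem_nhdsWithin,
    nhdsWithin_le_nhds (Metric.ball_mem_nhds p hr0)] with y hyY hyr
  rw [mem_ball_iff_norm] at hyr
  obtain ⟨h1, h2⟩ := hC y hyr
  have hyp : y ≠ p := fun h => disjoint_left.1 hXY hp (h ▸ hyY)
  have hπy : π y ≠ y := fun h => disjoint_left.1 hXY h1 (h.symm ▸ hyY)
  have h3 := h2 p hp (by simpa using hr0)
  rw [alpha_eq_kuoRatio_mul hyp hπy, mul_comm]
  refine mul_le_mul_of_nonneg_right ?_ (kuoRatio_nonneg y)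
  rw [div_le_iff₀ (norm_pos_iff.2 (sub_ne_zero.2 hyp)), norm_sub_rev y p]
  exact h3

theorem ConditionR.tendsto_beta (hL : IsOMinimal L) {dX : ℕ} (hX : IsDefinable L X)
    (hY : IsDefinable L Y) (hX2 : IsC2Submanifold dX X) (hXY : Disjoint X Y) (hp : p ∈ X)
    (hπ : IsLocalRetraction X p π) (hr : ConditionR Y X p π) :
    Tendsto (beta Y π) (𝓝[Y] p) (𝓝 0) := by
  obtain ⟨C, hC1, r, hr0, hC⟩ := hπ.exists_norm_le
  obtain ⟨K, hK0, U, hU, hK⟩ := hX2.exists_tangent_lipschitz hp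
  by_contra hcon
  obtain ⟨ε, hε, hfreq⟩ : ∃ ε > 0, ∃ᶠ y in 𝓝[Y] p, ε < beta Y π y := by
    by_contra hno
    push Not at hno
    refine hcon (Metric.tendsto_nhds.2 fun ε hε => ?_)
    filter_upwards [hno (ε / 2) (half_pos hε)] with y hy
    rw [Real.dist_0_eq_abs, abs_of_nonneg (beta_nonneg y)]
    linarith
  -- The last clause is the definable substitute for `x = π y`.
  set P : E n → E n → E n → Prop := fun y x m => y ∈ Y ∧ ‖y - p‖ < r ∧ x ∈ X ∧ ‖m‖ = 1 ∧
    m ∈ (tangent Y y)ᗮ ∧ ε * ‖x - y‖ ≤ inner ℝ (x - y) m ∧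
    ∀ z : E n, z ∈ X → ‖z - p‖ < r → ‖x - y‖ ≤ C * ‖z - y‖
  have hxp : ∀ y x m, P y x m → ‖x - y‖ ≤ C * ‖y - p‖ := fun y x m h => by
    have := h.2.2.2.2.2.2 p hp (by simpa using hr0)
    rwa [norm_sub_rev p y] at this
  obtain ⟨y, x, m, hy, hx, hm, hev⟩ := hL.exists_curve (P := P) (p := p)
    (M := C * r + r + ‖p‖ + 1) (by
      refine .and (hY.mem (.tuple _)) (.and (hL.lt
        (hL.defFun_norm (hL.vec_sub (.tuple _) (.const p))) (.const r))
        (.and (hX.mem (.tuple _)) (.and ((hL.defFun_norm (.tuple _)).eq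
        (.const 1)) (.and
        (defPred_mem_tangent_orthogonal hL hY (.tuple _) (.tuple _)) (.and
        (hL.le (hL.mul (.const ε) (hL.defFun_norm (hL.vec_sub (.tuple _) (.tuple _))))
          (hL.defFun_inner (hL.vec_sub (.tuple _) (.tuple _)) (.tuple _)))
        (.forall_vec (.imp (hX.mem (.tuple _)) (.imp (hL.lt (hL.defFun_norm (hL.vec_sub (.tuple _)
          (.const p))) (.const r)) ?_))))))))
      exact hL.le (hL.defFun_norm (hL.vec_sub (.tuple _) (.tuple _)))
        (hL.mul (.const C) (hL.defFun_norm (hL.vec_sub (.tuple _) (.tuple _)))))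
    (by
      intro y x m h
      have h1 := hxp y x m h
      have h2 := h.2.1
      have h3 : C * ‖y - p‖ ≤ C * r := by gcongr
      have h4 : ‖y‖ ≤ ‖y - p‖ + ‖p‖ := by simpa using norm_add_le (y - p) p
      have h5 : ‖x‖ ≤ ‖x - y‖ + ‖y‖ := by simpa using norm_add_le (x - y) y
      have h6 : 0 ≤ C * r := by positivity
      refine ⟨by linarith, by linarith, ?_⟩
      rw [h.2.2.2.1]
      linarith [norm_nonneg p])
    (by
      have hne : 𝓝[Y] p ≤ 𝓝[≠] p := nhdsWithin_mono _ fun y hyY h =>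
        disjoint_left.1 hXY hp (h ▸ hyY)
      refine Frequently.filter_mono ?_ hne
      refine (hfreq.and_eventually (Filter.Eventually.and self_mem_nhdsWithin
        (nhdsWithin_le_nhds (Metric.ball_mem_nhds p hr0)))).mono ?_
      rintro y ⟨hβ, hyY, hyr⟩
      have hyr : ‖y - p‖ < r := mem_ball_iff_norm.1 hyr
      have hyY : y ∈ Y := hyY
      obtain ⟨h1, h2⟩ := hC y hyr
      have hπy : π y ≠ y := fun h => disjoint_left.1 hXY h1 (h.symm ▸ hyY)
      obtain ⟨m, hm, hm1, hlt⟩ := exists_normal_of_lt_eta hε.le hβ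
      refine ⟨π y, m, hyY, hyr, h1, hm1, hm, ?_, h2⟩
      rw [real_inner_smul_left, lt_inv_mul_iff₀ (norm_pos_iff.2 (sub_ne_zero.2 hπy))] at hlt
      linarith)
  have hyp := hev.mono fun t ht => ht.1
  have hP := hev.mono fun t ht => ht.2
  have hC' : ∀ᶠ t in 𝓝[>] (0 : ℝ), ‖x t - y t‖ ≤ C * t := hev.mono fun t ht => by
    simpa [ht.1] using hxp _ _ _ ht.2
  have hne : ∀ᶠ t in 𝓝[>] (0 : ℝ), 0 < ‖x t - y t‖ := hP.mono fun t ht => by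
    refine norm_pos_iff.2 (sub_ne_zero.2 fun h => ?_)
    exact disjoint_left.1 hXY ht.2.2.1 (h ▸ ht.1)
  obtain ⟨c, hc, D, hD⟩ := hL.exists_frequently_tangent (X := X) (Y := Y) hy hx hm hε hyp
    (hP.mono fun t ht => ht.1) (hP.mono fun t ht => ht.2.2.1) (hP.mono fun t ht => ht.2.2.2.1)
    (hP.mono fun t ht => ht.2.2.2.2.1) (hP.mono fun t ht => ht.2.2.2.2.2.1) hC' hne
  have hid0 : Tendsto (fun t : ℝ => t) (𝓝[>] 0) (𝓝 0) := nhdsWithin_le_nhds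
  have hy0 : Tendsto y (𝓝[>] 0) (𝓝 p) := by
    refine tendsto_iff_norm_sub_tendsto_zero.2 (hid0.congr' ?_)
    filter_upwards [hyp] with t ht using ht.symm
  have hq0 : Tendsto (fun t => ‖x t - y t‖) (𝓝[>] 0) (𝓝 0) :=
    squeeze_zero' (.of_forall fun t => norm_nonneg _) hC' (by simpa using hid0.const_mul C)
  have hx0 : Tendsto x (𝓝[>] 0) (𝓝 p) := by
    have h : Tendsto (fun t => (x t - y t) + y t) (𝓝[>] 0) (𝓝 (0 + p)) :=
      (tendsto_zero_iff_norm_tendsto_zero.2 hq0).add hy0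
    simpa using h
  have hπ0 : Tendsto (fun t => π (y t)) (𝓝[>] 0) (𝓝 p) := by
    have h : Tendsto (fun t => (π (y t) - y t) + y t) (𝓝[>] 0) (𝓝 (0 + p)) := by
      refine Tendsto.add (squeeze_zero_norm' (a := fun t => C * t) ?_
        (by simpa using hid0.const_mul C)) hy0
      filter_upwards [hev] with t ht
      have := (hC (y t) ht.2.2.1).2 p hp (by simpa using hr0)
      rwa [norm_sub_rev p, ht.1] at this
    simpa using h
  have hR : Tendsto (fun t => kuoRatio Y X p π (y t)) (𝓝[>] 0) (𝓝 0) :=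
    hr.comp (tendsto_nhdsWithin_iff.2 ⟨hy0, hP.mono fun t ht => ht.1⟩)
  -- This is the factor of `‖x t - y t‖` in the upper bound `hfinal`, to be compared with the fixed
  -- `c`.
  have hlim : Tendsto (fun t => (D * (1 + K * ((1 + C) * ‖x t - y t‖))) *
      (kuoRatio Y X p π (y t) * C) + t * (K * (1 + C) * D)) (𝓝[>] 0) (𝓝 0) := by
    have h1 : Tendsto (fun t => D * (1 + K * ((1 + C) * ‖x t - y t‖))) (𝓝[>] 0) (𝓝 D) := by
      simpa using (((hq0.const_mul (1 + C)).const_mul K).const_add 1).const_mul D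
    simpa using (h1.mul (hR.mul_const C)).add (hid0.mul_const (K * (1 + C) * D))
  have hpos : ∀ᶠ t in 𝓝[>] (0 : ℝ), 0 < t := self_mem_nhdsWithin
  have hball : Metric.ball p r ∈ 𝓝 p := Metric.ball_mem_nhds p hr0
  obtain ⟨t, ⟨w, hw, hwD, hwm⟩, ⟨hty, hPt⟩, ht0, hqt, hltc, hxU, hπU, hxr⟩ :=
    (hD.and_eventually (hev.and (hpos.and (hne.and ((hlim.eventually (gt_mem_nhds hc)).and
      ((hx0.eventually hU).and ((hπ0.eventually hU).and (hx0.eventually hball)))))))).exists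
  obtain ⟨hyY, hyr, hxX, hm1, hmY, -, -⟩ := hPt
  obtain ⟨hπX, hπle⟩ := hC (y t) hyr
  have hπx : ‖π (y t) - y t‖ ≤ C * ‖x t - y t‖ := hπle _ hxX (mem_ball_iff_norm.1 hxr)
  -- `alpha` concerns the tangent space at `π (y t)`, not at `x t`. Both points lie within a
  -- multiple of `‖x t - y t‖` of `y t`, so moving `w` costs `O(‖x t - y t‖)`, which the factor `t`
  -- makes negligible.
  obtain ⟨w', hw', hww'⟩ := hK (x t) ⟨hxX, hxU⟩ (π (y t)) ⟨hπX, hπU⟩ w hw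
  have hdist : ‖x t - π (y t)‖ ≤ (1 + C) * ‖x t - y t‖ := by
    calc ‖x t - π (y t)‖ = ‖(x t - y t) - (π (y t) - y t)‖ := by congr 1; abel
      _ ≤ ‖x t - y t‖ + ‖π (y t) - y t‖ := norm_sub_le _ _
      _ ≤ (1 + C) * ‖x t - y t‖ := by linarith
  have hD0 : 0 ≤ D := (norm_nonneg w).trans hwD
  have hdiff : ‖w - w'‖ ≤ K * ((1 + C) * ‖x t - y t‖) * D := hww'.trans (by gcongr)
  have hw'D : ‖w'‖ ≤ D * (1 + K * ((1 + C) * ‖x t - y t‖)) := by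
    calc ‖w'‖ = ‖w - (w - w')‖ := by congr 1; abel
      _ ≤ ‖w‖ + ‖w - w'‖ := norm_sub_le _ _
      _ ≤ _ := by linarith
  have hyp' : y t ≠ p := fun h => disjoint_left.1 hXY hp (h ▸ hyY)
  have hπy : π (y t) ≠ y t := fun h => disjoint_left.1 hXY hπX (h.symm ▸ hyY)
  have hα : t * alpha Y X π (y t) ≤ kuoRatio Y X p π (y t) * C * ‖x t - y t‖ := by
    rw [alpha_eq_kuoRatio_mul hyp' hπy, hty]
    have h1 := mul_le_mul_of_nonneg_left hπx (kuoRatio_nonneg (Y := Y) (X := X) (p := p) (π := π)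
      (y t))
    calc t * (kuoRatio Y X p π (y t) * (‖π (y t) - y t‖ / t))
        = kuoRatio Y X p π (y t) * ‖π (y t) - y t‖ := by field_simp
      _ ≤ _ := by linarith
  have hinner : |inner ℝ w (m t)| ≤ ‖w'‖ * alpha Y X π (y t) + ‖w - w'‖ := by
    have h1 := abs_inner_le_mul_subspaceDist hw' hmY hm1
    have h2 := abs_real_inner_le_norm (w - w') (m t)
    rw [hm1, mul_one] at h2
    have h3 : inner ℝ w (m t) = inner ℝ w' (m t) + inner ℝ (w - w') (m t) := by
      rw [inner_sub_left]; ring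
    rw [h3]
    exact (abs_add_le _ _).trans (add_le_add h1 h2)
  have hfinal : c * ‖x t - y t‖ ≤ ((D * (1 + K * ((1 + C) * ‖x t - y t‖))) *
      (kuoRatio Y X p π (y t) * C) + t * (K * (1 + C) * D)) * ‖x t - y t‖ := by
    calc c * ‖x t - y t‖ ≤ t * |inner ℝ w (m t)| := hwm
      _ ≤ t * (‖w'‖ * alpha Y X π (y t) + ‖w - w'‖) := by gcongr
      _ = ‖w'‖ * (t * alpha Y X π (y t)) + t * ‖w - w'‖ := by ring
      _ ≤ (D * (1 + K * ((1 + C) * ‖x t - y t‖))) *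
            (kuoRatio Y X p π (y t) * C * ‖x t - y t‖) +
          t * (K * ((1 + C) * ‖x t - y t‖) * D) :=
        add_le_add (mul_le_mul hw'D hα (mul_nonneg ht0.le (alpha_nonneg _)) (by positivity))
          (mul_le_mul_of_nonneg_left hdiff ht0.le)
      _ = _ := by ring
  exact absurd (le_of_mul_le_mul_right hfinal hqt) (not_le.2 hltc)

/-- The Kuo-Verdier condition implies the ratio test. -/
theorem ConditionW.conditionR (hp : p ∈ X) (hπ : IsLocalRetraction X p π)
    (hw : ConditionW Y X p) : ConditionR Y X p π := by
  obtain ⟨C, hC1, r, hr0, hC⟩ := hπ.exists_norm_le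
  obtain ⟨B, U, hU, hB⟩ := hw
  have hnorm : Tendsto (fun y => ‖y - p‖) (𝓝[Y] p) (𝓝 0) :=
    (tendsto_iff_norm_sub_tendsto_zero.1 tendsto_id).mono_left nhdsWithin_le_nhds
  have hball : ∀ᶠ y in 𝓝[Y] p, y ∈ Metric.ball p r :=
    nhdsWithin_le_nhds (Metric.ball_mem_nhds p hr0)
  have hπ0 : Tendsto π (𝓝[Y] p) (𝓝 p) := by
    have h : Tendsto (fun y => (π y - y) + y) (𝓝[Y] p) (𝓝 (0 + p)) := by
      refine Tendsto.add (squeeze_zero_norm' (a := fun y => C * ‖y - p‖) ?_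
        (by simpa using hnorm.const_mul C)) (tendsto_id.mono_left nhdsWithin_le_nhds)
      filter_upwards [hball] with y hy
      have := (hC y (mem_ball_iff_norm.1 hy)).2 p hp (by simpa using hr0)
      rwa [norm_sub_rev p] at this
    simpa using h
  refine squeeze_zero' (g := fun y => ‖y - p‖ * B) (.of_forall kuoRatio_nonneg) ?_
    (by simpa using hnorm.mul_const B)
  filter_upwards [self_mem_nhdsWithin, hball, nhdsWithin_le_nhds hU, hπ0.eventually hU]
    with y hyY hyr hyU hπU
  have h1 := hB y ⟨hyY, hyU⟩ (π y) ⟨(hC y (mem_ball_iff_norm.1 hyr)).1, hπU⟩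
  rw [kuoRatio, mul_div_assoc]
  exact mul_le_mul_of_nonneg_left h1 (norm_nonneg _)

end Main

end Strata

theorem proposition3p2 (L : FirstOrder.Language.{u, v}) [L.Structure ℝ]
    (hL : Strata.IsOMinimal L) (n : ℕ) :
    -- (r) implies (b) at each point of `X`
    (∀ (X Y : Set (Strata.E n)) (dX dY : ℕ),
      Strata.IsDefinable L X → Strata.IsDefinable L Y →
      Strata.IsC2Submanifold dX X → Strata.IsC2Submanifold dY Y → Disjoint X Y →
      ∀ p ∈ X, ∀ π : Strata.E n → Strata.E n, Strata.IsLocalRetraction X p π →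
        Strata.ConditionR Y X p π → Strata.ConditionB Y X p π) ∧
    -- (w) implies (b) for definable stratifications
    (∀ (S : Set (Strata.E n)) (strata : Set (Set (Strata.E n))),
      Strata.IsDefinableStratification L S strata →
      ∀ X ∈ strata, ∀ Y ∈ strata, X ≠ Y →
      ∀ p ∈ X, Strata.ConditionW Y X p →
        ∀ π : Strata.E n → Strata.E n, Strata.IsLocalRetraction X p π →
          Strata.ConditionB Y X p π) := by
  refine ⟨fun X Y dX dY hX hY hX2 _ hXY p hp π hπ hr =>
    ⟨hr.tendsto_alpha hXY hp hπ, hr.tendsto_beta hL hX hY hX2 hXY hp hπ⟩,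
    fun S strata hS X hX Y hY hne p hp hw π hπ => ?_⟩
  have hXY := hS.pairwise_disjoint X hX Y hY hne
  obtain ⟨dX, hX2⟩ := hS.submanifold X hX
  have hr := hw.conditionR hp hπ
  exact ⟨hr.tendsto_alpha hXY hp hπ,
    hr.tendsto_beta hL (hS.definable X hX) (hS.definable Y hY) hX2 hXY hp hπ⟩
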